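/- Let $N\in\mathbb N$, let $1<p<N$, and let $\Omega\subset\mathbb R^N$ be a bounded open set. Let $H:\mathbb R^N\to\mathbb R$ be such that (i) $H\in C^2(\mathbb R^N\setminus\{0\})$, $H$ is even, and $H(\xi)>0$ for all $\xi\ne 0$; (ii) $H(t\xi)=tH(\xi)$ for all $\xi\neq0$ and $t>0$; (iii) there is $\lambda>0$ such that $D^2H(\xi)\zeta\cdot\zeta\ge\lambda|\zeta|^2$ for all $\xi\in\partial\{\eta\in\mathbb R^N:H(\eta)<1\}$ and all $\zeta$ with $\nabla H(\xi)\cdot\zeta=0$. Let $W^{1,p}_0(\Omega)$ be the closure of $C^\infty_c(\Omega)$ in $W^{1,p}(\Omega)$. A function $G:\Omega\times(0,\infty)\to[0,\infty)$ is Carathéodory if $s\mapsto G(x,s)$ is continuous for a.e. $x\in\Omega$ and $x\mapsto G(x,s)$ is measurable for every $s>0$. For such $G$, a weak solution of $$-\Delta_p^H v:=-\operatorname{div}\big(H^{p-1}(\nabla v)\nabla H(\nabla v)\big)=G(x,v)\ \text{ in }\Omega,\qquad v=0\ \text{ on }\partial\Omega,$$ is a function $v\in W_0^{1,p}(\Omega)$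 with $v>0$ a.e. in $\Omega$ and $G(\cdot,v)\in L^1_{\rm loc}(\Omega)$ such that $$\int_\Omega H^{p-1}(\nabla v)\nabla H(\nabla v)\cdot\nabla\varphi\,dx=\int_\Omega G(x,v)\varphi\,dx\qquad\text{for all }\varphi\in C^1_c(\Omega),$$ where $H^{p-1}(\xi)\nabla H(\xi)$ is understood to be $0$ at $\xi=0$. Let $G_1,G_2:\Omega\times(0,\infty)\to[0,\infty)$ be Carathéodory functions such that $G_1(x,s)\le G_2(x,s)$ for a.e. $x\in\Omega$ and all $s>0$, and such that for at least one $i\in\{1,2\}$ the map $s\mapsto G_i(x,s)/s^{p-1}$ is strictly decreasing on $(0,\infty)$ for a.e. $x\in\Omega$. If $v_1$ and $v_2$ are weak solutions of the above problem with $G=G_1$ and $G=G_2$ respectively, then $v_1\le v_2$ a.e. in $\Omega$. -/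

import Mathlib

open MeasureTheory Set Filter Topology
open scoped ContDiff

/-- Conditions on the anisotropy `H : ℝᴺ → ℝ`: it is even, `C²` and positive away from the origin,
positively `1`-homogeneous, and uniformly elliptic, i.e. `D²H(ξ)ζ·ζ ≥ l|ζ|²` for `ξ` on the boundary
of `{H < 1}` and `ζ` orthogonal to `∇H(ξ)`. -/
structure IsEllipticFinsler {N : ℕ} (H : EuclideanSpace ℝ (Fin N) → ℝ) : Prop where
  contDiffOn : ContDiffOn ℝ 2 H {0}ᶜ
  even : ∀ ξ, H (-ξ) = H ξ
  pos : ∀ ξ, ξ ≠ 0 → 0 < H ξ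
  homogeneous : ∀ ξ, ξ ≠ 0 → ∀ t : ℝ, 0 < t → H (t • ξ) = t * H ξ
  elliptic : ∃ l : ℝ, 0 < l ∧ ∀ ξ ∈ frontier {ξ | H ξ < 1}, ∀ ζ,
    inner ℝ (gradient H ξ) ζ = 0 → l * ‖ζ‖ ^ 2 ≤ fderiv ℝ (fderiv ℝ H) ξ ζ ζ

open Classical in
/-- The field `ξ ↦ H(ξ)^(p-1) ∇H(ξ)`, with its usual (continuous) value `0` at `ξ = 0`,
where `H` is not differentiable. -/
noncomputable def finslerFlux {N : ℕ} (p : ℝ) (H : EuclideanSpace ℝ (Fin N) → ℝ)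
    (ξ : EuclideanSpace ℝ (Fin N)) : EuclideanSpace ℝ (Fin N) :=
  if ξ = 0 then 0 else (H ξ) ^ (p - 1) • gradient H ξ

/-- `φ ∈ C^k_c(Ω)`. -/
structure IsTestFunction {N : ℕ} (k : ℕ∞) (Ω : Set (EuclideanSpace ℝ (Fin N)))
    (φ : EuclideanSpace ℝ (Fin N) → ℝ) : Prop where
  contDiff : ContDiff ℝ k φ
  hasCompactSupport : HasCompactSupport φ
  tsupport_subset : tsupport φ ⊆ Ω

/-- `V` is the weak (distributional) gradient of `u` in `Ω`. -/
structure IsWeakGradient {N : ℕ} (Ω : Set (EuclideanSpace ℝ (Fin N)))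
    (u : EuclideanSpace ℝ (Fin N) → ℝ)
    (V : EuclideanSpace ℝ (Fin N) → EuclideanSpace ℝ (Fin N)) : Prop where
  locallyIntegrableOn : LocallyIntegrableOn u Ω
  locallyIntegrableOn_grad : LocallyIntegrableOn V Ω
  integral_eq : ∀ φ, IsTestFunction ⊤ Ω φ → ∀ i : Fin N,
    ∫ x in Ω, u x * gradient φ x i = -∫ x in Ω, V x i * φ x

/-- `u ∈ W₀^{1,p}(Ω)` with weak gradient `V`: `u` and `V` are in `L^p(Ω)`, and `u` is a limit, in the
norm of `W^{1,p}(Ω)`, of functions in `C^∞_c(Ω)`. -/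
structure MemSobolevZero {N : ℕ} (p : ℝ) (Ω : Set (EuclideanSpace ℝ (Fin N)))
    (u : EuclideanSpace ℝ (Fin N) → ℝ)
    (V : EuclideanSpace ℝ (Fin N) → EuclideanSpace ℝ (Fin N)) : Prop where
  isWeakGradient : IsWeakGradient Ω u V
  memLp : MemLp u (ENNReal.ofReal p) (volume.restrict Ω)
  memLp_grad : MemLp V (ENNReal.ofReal p) (volume.restrict Ω)
  approx : ∃ φ : ℕ → EuclideanSpace ℝ (Fin N) → ℝ, (∀ n, IsTestFunction ⊤ Ω (φ n)) ∧
    Tendsto (fun n => eLpNorm (fun x => u x - φ n x) (ENNReal.ofReal p) (volume.restrict Ω))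
      atTop (𝓝 0) ∧
    Tendsto (fun n => eLpNorm (fun x => V x - gradient (φ n) x) (ENNReal.ofReal p)
      (volume.restrict Ω)) atTop (𝓝 0)

/-- `G : Ω × (0,∞) → [0,∞)` is a Carathéodory function (the values of `G` at points outside
`Ω × (0,∞)` play no role). Measurability in `x` is Lebesgue measurability on `Ω`. -/
structure IsNonnegCaratheodory {N : ℕ} (Ω : Set (EuclideanSpace ℝ (Fin N)))
    (G : EuclideanSpace ℝ (Fin N) → ℝ → ℝ) : Prop where
  nonneg : ∀ x ∈ Ω, ∀ s : ℝ, 0 < s → 0 ≤ G x s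
  continuousOn : ∀ᵐ x ∂(volume.restrict Ω), ContinuousOn (G x) (Ioi 0)
  aemeasurable : ∀ s : ℝ, 0 < s → AEMeasurable (fun x => G x s) (volume.restrict Ω)

/-- `u` is a (positive) weak solution of `-Δ_p^H u = G(x,u)` in `Ω`, `u = 0` on `∂Ω`. -/
def IsWeakSolution {N : ℕ} (p : ℝ) (H : EuclideanSpace ℝ (Fin N) → ℝ)
    (Ω : Set (EuclideanSpace ℝ (Fin N))) (G : EuclideanSpace ℝ (Fin N) → ℝ → ℝ)
    (u : EuclideanSpace ℝ (Fin N) → ℝ) : Prop :=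
  (∀ᵐ x ∂(volume.restrict Ω), 0 < u x) ∧
  LocallyIntegrableOn (fun x => G x (u x)) Ω ∧
  ∃ V : EuclideanSpace ℝ (Fin N) → EuclideanSpace ℝ (Fin N), MemSobolevZero p Ω u V ∧
    ∀ φ, IsTestFunction 1 Ω φ →
      ∫ x in Ω, inner ℝ (finslerFlux p H (V x)) (gradient φ x) = ∫ x in Ω, G x (u x) * φ x

/-!
The comparison rests on Picone's inequality. Write `Y(ξ) = H(ξ)^(p-1) ∇H(ξ)` for the flux. Ellipticity
and homogeneity make `H` convex (`IsEllipticFinsler.fderiv_apply_le`), hence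
`Y(ξ)·η ≤ H(ξ)^(p-1) H(η)` with equality at `η = ξ`; beyond this only the growth of `Y` matters. Together with
Young's inequality this gives, for `ψ₁ = (v₁^p - v₂^p)⁺ / v₁^(p-1)` and
`ψ₂ = (v₁^p - v₂^p)⁺ / v₂^(p-1)`, the pointwise bound `Y(∇v₁)·∇ψ₁ - Y(∇v₂)·∇ψ₂ ≥ 0`. Testing the two
equations with `ψ₁` and `ψ₂` yields `∫ G₂(x,v₂) ψ₂ ≤ ∫ G₁(x,v₁) ψ₁`, while monotonicity of
`s ↦ G_i(x,s) / s^(p-1)` makes the integrands strictly ordered the other way round where `v₁ > v₂`.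
So that set is null.

The functions `ψ₁`, `ψ₂` are not admissible as they stand. They are replaced by `C¹` functions of
`(v₁, v₂)` with bounded derivatives (`piconeFst`, `piconeSnd`): `v₂` is shifted by `ε`, `v₁` is shifted
and truncated by the concave function `ε + s / (1 + ε s)`, and the positive part is smoothed. Picone's
inequality survives with explicit errors that vanish as `ε → 0` (`picone_regularized`,
`IsEllipticFinsler.picone`). Since the regularized functions are `C¹`, composing them with test
functions that approximate `v₁` and `v₂` gives test functions, and no calculus of weak derivatives is
needed (`IsTestLimit.comp`).

The source `g = G_i(x,v_i)` is only locally integrable. Testing with a smoothed `|φ|` gives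
`∫ g|φ| ≤ ∫ |Y||∇φ|`, so that `g φ_n` is Cauchy in `L¹` whenever the gradients of the test functions
`φ_n` converge in `L¹` with weight `|Y|`; hence the weak formulation extends to limits of test
functions (`IsNonnegDivergence.integral_eq_of_isTestLimit`). In particular `G₁(x,v₁) v₁` is
integrable. As `ε → 0`, it dominates the term with `ψ₁`, and Fatou's lemma handles the term with
`ψ₂` (`ae_le_of_forall_div_lt`).
-/

/-! ### Convexity and growth of the anisotropy -/

namespace IsEllipticFinsler

variable {N : ℕ} {H : EuclideanSpace ℝ (Fin N) → ℝ} {ξ η : EuclideanSpace ℝ (Fin N)}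

theorem contDiffAt (hH : IsEllipticFinsler H) (hξ : ξ ≠ 0) : ContDiffAt ℝ 2 H ξ :=
  hH.contDiffOn.contDiffAt (isOpen_compl_singleton.mem_nhds hξ)

theorem differentiableAt (hH : IsEllipticFinsler H) (hξ : ξ ≠ 0) : DifferentiableAt ℝ H ξ :=
  (hH.contDiffAt hξ).differentiableAt (by norm_num)

theorem differentiableAt_fderiv (hH : IsEllipticFinsler H) (hξ : ξ ≠ 0) :
    DifferentiableAt ℝ (fderiv ℝ H) ξ :=
  ((hH.contDiffAt hξ).fderiv_right (m := 1) (by norm_num)).differentiableAt (by norm_num)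

theorem continuousOn_fderiv (hH : IsEllipticFinsler H) : ContinuousOn (fderiv ℝ H) {0}ᶜ :=
  fun _ hξ => (hH.differentiableAt_fderiv hξ).continuousAt.continuousWithinAt

theorem fderiv_smul (hH : IsEllipticFinsler H) (hξ : ξ ≠ 0) {t : ℝ} (ht : 0 < t) :
    fderiv ℝ H (t • ξ) = fderiv ℝ H ξ := by
  have h1 : (fun η => H (t • η)) =ᶠ[𝓝 ξ] fun η => t • H η := by
    filter_upwards [isOpen_compl_singleton.mem_nhds hξ] with η hη
    exact hH.homogeneous η hη t ht
  have h2 := h1.fderiv_eq (𝕜 := ℝ)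
  rw [fderiv_comp_smul, fderiv_fun_const_smul (hH.differentiableAt hξ)] at h2
  exact smul_right_injective _ ht.ne' h2

theorem fderiv_fderiv_smul (hH : IsEllipticFinsler H) (hξ : ξ ≠ 0) {t : ℝ} (ht : 0 < t) :
    t • fderiv ℝ (fderiv ℝ H) (t • ξ) = fderiv ℝ (fderiv ℝ H) ξ := by
  have h1 : (fun η => fderiv ℝ H (t • η)) =ᶠ[𝓝 ξ] fderiv ℝ H := by
    filter_upwards [isOpen_compl_singleton.mem_nhds hξ] with η hη
    exact hH.fderiv_smul hη ht
  have h2 := h1.fderiv_eq (𝕜 := ℝ)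
  rwa [fderiv_comp_smul] at h2

/-- Euler's identity `∇H(ξ)·ξ = H(ξ)`. -/
theorem fderiv_apply_self (hH : IsEllipticFinsler H) (hξ : ξ ≠ 0) : fderiv ℝ H ξ ξ = H ξ := by
  have hl : HasDerivAt (fun t : ℝ => t • ξ) ξ 1 := by
    simpa using (hasDerivAt_id (1 : ℝ)).smul_const ξ
  have h0 : HasFDerivAt H (fderiv ℝ H ξ) ((1 : ℝ) • ξ) := by
    simpa using (hH.differentiableAt hξ).hasFDerivAt
  have h1 : HasDerivAt (fun t : ℝ => H (t • ξ)) (fderiv ℝ H ξ ξ) 1 := h0.comp_hasDerivAt 1 hl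
  have h2 : HasDerivAt (fun t : ℝ => t * H ξ) (H ξ) 1 := by
    simpa using (hasDerivAt_id (1 : ℝ)).mul_const (H ξ)
  refine h1.unique (h2.congr_of_eventuallyEq ?_)
  filter_upwards [lt_mem_nhds (zero_lt_one (α := ℝ))] with t ht
  exact hH.homogeneous ξ hξ t ht

/-- Euler's identity for the `0`-homogeneous map `∇H`. -/
theorem fderiv_fderiv_apply_self (hH : IsEllipticFinsler H) (hξ : ξ ≠ 0) :
    fderiv ℝ (fderiv ℝ H) ξ ξ = 0 := by
  have hl : HasDerivAt (fun t : ℝ => t • ξ) ξ 1 := by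
    simpa using (hasDerivAt_id (1 : ℝ)).smul_const ξ
  have h0 : HasFDerivAt (fderiv ℝ H) (fderiv ℝ (fderiv ℝ H) ξ) ((1 : ℝ) • ξ) := by
    simpa using (hH.differentiableAt_fderiv hξ).hasFDerivAt
  have h1 : HasDerivAt (fun t : ℝ => fderiv ℝ H (t • ξ)) (fderiv ℝ (fderiv ℝ H) ξ ξ) 1 :=
    h0.comp_hasDerivAt 1 hl
  refine h1.unique ((hasDerivAt_const (1 : ℝ) (fderiv ℝ H ξ)).congr_of_eventuallyEq ?_)
  filter_upwards [lt_mem_nhds (zero_lt_one (α := ℝ))] with t ht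
  exact hH.fderiv_smul hξ ht

theorem fderiv_fderiv_symm (hH : IsEllipticFinsler H) (hξ : ξ ≠ 0)
    (ζ ζ' : EuclideanSpace ℝ (Fin N)) :
    fderiv ℝ (fderiv ℝ H) ξ ζ ζ' = fderiv ℝ (fderiv ℝ H) ξ ζ' ζ :=
  ((hH.contDiffAt hξ).isSymmSndFDerivAt (by simp)).eq ζ ζ'

theorem mem_frontier (hH : IsEllipticFinsler H) (hξ : ξ ≠ 0) (h1 : H ξ = 1) :
    ξ ∈ frontier {ξ | H ξ < 1} := by
  refine ⟨?_, fun h => ?_⟩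
  swap
  · have h2 : H ξ < 1 := interior_subset (s := {ξ | H ξ < 1}) h
    exact h2.ne h1
  have hl : Tendsto (fun t : ℝ => t • ξ) (𝓝[<] 1) (𝓝 ξ) := by
    have : ContinuousAt (fun t : ℝ => t • ξ) 1 := by fun_prop
    simpa using this.tendsto.mono_left (nhdsWithin_le_nhds (s := Iio 1))
  refine mem_closure_of_tendsto hl ?_
  filter_upwards [Ioo_mem_nhdsLT (zero_lt_one (α := ℝ))] with t ht
  show H (t • ξ) < 1
  rw [hH.homogeneous ξ hξ t ht.1, h1, mul_one]
  exact ht.2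

/-- `D²H` is positive semidefinite: a vector splits into its component along `ξ`, which lies in the
kernel of `D²H(ξ)`, and a component tangent to the level set of `H`, where ellipticity applies. -/
theorem fderiv_fderiv_nonneg (hH : IsEllipticFinsler H) (hξ : ξ ≠ 0)
    (ζ : EuclideanSpace ℝ (Fin N)) : 0 ≤ fderiv ℝ (fderiv ℝ H) ξ ζ ζ := by
  have hpos := hH.pos ξ hξ
  have hs : 0 < (H ξ)⁻¹ := inv_pos.2 hpos
  have hξ' : (H ξ)⁻¹ • ξ ≠ 0 := smul_ne_zero hs.ne' hξ
  have h1 : H ((H ξ)⁻¹ • ξ) = 1 := by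
    rw [hH.homogeneous ξ hξ _ hs, inv_mul_cancel₀ hpos.ne']
  rw [← hH.fderiv_fderiv_smul hξ hs]
  generalize (H ξ)⁻¹ • ξ = υ at hξ' h1
  obtain ⟨l, hl, hell⟩ := hH.elliptic
  have hE := hH.fderiv_apply_self hξ'
  have hF := hH.fderiv_fderiv_apply_self hξ'
  have hsym := hH.fderiv_fderiv_symm hξ' ζ υ
  set c := fderiv ℝ H υ ζ
  have h2 := hell υ (hH.mem_frontier hξ' h1) (ζ - c • υ) (by
    rw [inner_gradient_left]
    simp [hE, h1, c])
  have h3 : fderiv ℝ (fderiv ℝ H) υ (ζ - c • υ) (ζ - c • υ) = fderiv ℝ (fderiv ℝ H) υ ζ ζ := by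
    simp [hF, hsym]
  rw [h3] at h2
  simp only [FunLike.coe_smul, Pi.smul_apply, smul_eq_mul]
  have : 0 ≤ l * ‖ζ - c • υ‖ ^ 2 := by positivity
  exact mul_nonneg hs.le (this.trans h2)

/-- Convexity of `H` in the form of a subgradient inequality. -/
theorem fderiv_apply_le (hH : IsEllipticFinsler H) (hξ : ξ ≠ 0) (hη : η ≠ 0) :
    fderiv ℝ H ξ η ≤ H η := by
  by_cases hz : ∃ s ∈ Icc (0 : ℝ) 1, (1 - s) • ξ + s • η = 0
  · -- The segment meets the origin, so `η` is a negative multiple of `ξ`.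
    obtain ⟨s, ⟨hs0, hs1⟩, hs⟩ := hz
    have hs0' : 0 < s := by
      rcases hs0.eq_or_lt with rfl | h
      · simp [hξ] at hs
      · exact h
    have h1 := congrArg (fderiv ℝ H ξ) hs
    simp only [map_add, map_smul, map_zero, hH.fderiv_apply_self hξ, smul_eq_mul] at h1
    have h2 : 0 ≤ (1 - s) * H ξ := mul_nonneg (by linarith) (hH.pos ξ hξ).le
    have h3 : fderiv ℝ H ξ η ≤ 0 := by
      by_contra! h
      have := mul_pos hs0' h
      linarith
    exact h3.trans (hH.pos η hη).le
  · push Not at hz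
    -- `s ↦ ∇H((1-s)ξ + sη)·η` is monotone, because `D²H(z)z = 0` turns its derivative into
    -- `D²H(z)η·η / (1-s)`.
    have hder : ∀ s ∈ Icc (0 : ℝ) 1,
        HasDerivAt (fun s : ℝ => fderiv ℝ H ((1 - s) • ξ + s • η) η)
          (fderiv ℝ (fderiv ℝ H) ((1 - s) • ξ + s • η) (η - ξ) η) s := by
      intro s hs
      have hl : HasDerivAt (fun s : ℝ => (1 - s) • ξ + s • η) (η - ξ) s := by
        have := (((hasDerivAt_id s).const_sub 1).smul_const ξ).add
          ((hasDerivAt_id s).smul_const η)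
        refine this.congr_deriv ?_
        simp only [neg_smul, one_smul]
        abel
      have := (hH.differentiableAt_fderiv (hz s hs)).hasFDerivAt.comp_hasDerivAt s hl
      exact this.clm_apply (hasDerivAt_const s η) |>.congr_deriv (by simp)
    have hmono : MonotoneOn (fun s : ℝ => fderiv ℝ H ((1 - s) • ξ + s • η) η) (Icc 0 1) := by
      refine monotoneOn_of_deriv_nonneg (convex_Icc 0 1)
        (fun s hs => (hder s hs).continuousAt.continuousWithinAt)
        (fun s hs => (hder s (interior_subset hs)).differentiableAt.differentiableWithinAt) ?_
      intro s hs
      have hs' := interior_subset hs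
      rw [interior_Icc] at hs
      rw [(hder s hs').deriv]
      have hz' := hH.fderiv_fderiv_apply_self (hz s hs')
      have h3 := hH.fderiv_fderiv_nonneg (hz s hs') η
      set z := (1 - s) • ξ + s • η with hzdef
      have h1 : (1 - s) • (η - ξ) = η - z := by
        rw [hzdef]; module
      have h2 := congrArg (fun v => fderiv ℝ (fderiv ℝ H) z v η) h1
      simp only [map_smul, map_sub, hz', FunLike.coe_smul, Pi.smul_apply, smul_eq_mul,
        sub_zero] at h2
      rw [← h2] at h3
      have h4 : 0 < 1 - s := by linarith [hs.2]
      simpa only [map_sub] using nonneg_of_mul_nonneg_right h3 h4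
    have := hmono (left_mem_Icc.2 zero_le_one) (right_mem_Icc.2 zero_le_one) zero_le_one
    simpa [hH.fderiv_apply_self hη] using this

/-- `∇H` is bounded, being `0`-homogeneous and continuous on the unit sphere. -/
theorem exists_norm_fderiv_le (hH : IsEllipticFinsler H) :
    ∃ C : ℝ, 0 ≤ C ∧ ∀ ξ, ξ ≠ 0 → ‖fderiv ℝ H ξ‖ ≤ C := by
  have hS : IsCompact (Metric.sphere (0 : EuclideanSpace ℝ (Fin N)) 1) := isCompact_sphere 0 1
  obtain ⟨C, hC⟩ := hS.exists_bound_of_continuousOn (f := fderiv ℝ H)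
    (hH.continuousOn_fderiv.mono fun x hx => by
      rintro rfl
      simp at hx)
  refine ⟨max C 0, le_max_right _ _, fun ξ hξ => ?_⟩
  rw [← hH.fderiv_smul hξ (inv_pos.2 (norm_pos_iff.2 hξ))]
  refine (hC _ ?_).trans (le_max_left _ _)
  simp [norm_smul, hξ]

end IsEllipticFinsler

open Classical in
/-- The function `H` with its value at the origin, which `IsEllipticFinsler` leaves free, set to
the continuous value `0`. -/
noncomputable def finslerGauge {N : ℕ} (H : EuclideanSpace ℝ (Fin N) → ℝ)
    (ξ : EuclideanSpace ℝ (Fin N)) : ℝ :=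
  if ξ = 0 then 0 else H ξ

namespace IsEllipticFinsler

variable {N : ℕ} {H : EuclideanSpace ℝ (Fin N) → ℝ} {p : ℝ}

theorem finslerGauge_nonneg (hH : IsEllipticFinsler H) (ξ : EuclideanSpace ℝ (Fin N)) :
    0 ≤ finslerGauge H ξ := by
  unfold finslerGauge
  split_ifs with h
  exacts [le_rfl, (hH.pos ξ h).le]

theorem inner_finslerFlux_self (hH : IsEllipticFinsler H) (hp : 1 < p)
    (ξ : EuclideanSpace ℝ (Fin N)) :
    inner ℝ (finslerFlux p H ξ) ξ = finslerGauge H ξ ^ p := by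
  unfold finslerFlux finslerGauge
  split_ifs with h
  · rw [Real.zero_rpow (by linarith), inner_zero_left]
  · rw [real_inner_smul_left, inner_gradient_left, hH.fderiv_apply_self h,
      ← Real.rpow_add_one (hH.pos ξ h).ne', sub_add_cancel]

theorem inner_finslerFlux_le (hH : IsEllipticFinsler H) (hp : 1 < p)
    (ξ η : EuclideanSpace ℝ (Fin N)) :
    inner ℝ (finslerFlux p H ξ) η ≤ finslerGauge H ξ ^ (p - 1) * finslerGauge H η := by
  unfold finslerFlux finslerGauge
  split_ifs with h h' h'
  · simp
  · simp [Real.zero_rpow (by linarith : p - 1 ≠ 0)]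
  · simp [h']
  · rw [real_inner_smul_left, inner_gradient_left]
    exact mul_le_mul_of_nonneg_left (hH.fderiv_apply_le h h')
      (Real.rpow_nonneg (hH.pos ξ h).le _)

theorem exists_finslerGauge_le (hH : IsEllipticFinsler H) :
    ∃ C : ℝ, 0 ≤ C ∧ ∀ ξ, finslerGauge H ξ ≤ C * ‖ξ‖ := by
  obtain ⟨C, hC0, hC⟩ := hH.exists_norm_fderiv_le
  refine ⟨C, hC0, fun ξ => ?_⟩
  unfold finslerGauge
  split_ifs with h
  · positivity
  · rw [← hH.fderiv_apply_self h]
    exact (le_abs_self _).trans ((fderiv ℝ H ξ).le_of_opNorm_le (hC ξ h) ξ)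

theorem exists_norm_finslerFlux_le (hH : IsEllipticFinsler H) (hp : 1 < p) :
    ∃ C : ℝ, 0 ≤ C ∧ ∀ ξ, ‖finslerFlux p H ξ‖ ≤ C * ‖ξ‖ ^ (p - 1) := by
  obtain ⟨C, hC0, hC⟩ := hH.exists_norm_fderiv_le
  obtain ⟨D, hD0, hD⟩ := hH.exists_finslerGauge_le
  refine ⟨D ^ (p - 1) * C, by positivity, fun ξ => ?_⟩
  have hk := hD ξ
  unfold finslerFlux
  unfold finslerGauge at hk
  split_ifs at hk ⊢ with h
  · rw [norm_zero]; positivity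
  · have hpos := (hH.pos ξ h).le
    have h1 : ‖gradient H ξ‖ ≤ C := by
      rw [gradient, LinearIsometryEquiv.norm_map]
      exact hC ξ h
    rw [norm_smul, Real.norm_of_nonneg (by positivity), mul_right_comm,
      ← Real.mul_rpow hD0 (norm_nonneg ξ)]
    exact mul_le_mul (Real.rpow_le_rpow hpos hk (by linarith)) h1 (norm_nonneg _) (by positivity)

theorem measurable_finslerGauge (hH : IsEllipticFinsler H) : Measurable (finslerGauge H) := by
  refine measurable_of_continuousOn_compl_singleton 0 (hH.contDiffOn.continuousOn.congr ?_)
  intro ξ hξ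
  exact if_neg hξ

theorem measurable_finslerFlux (hH : IsEllipticFinsler H) : Measurable (finslerFlux p H) := by
  refine measurable_of_continuousOn_compl_singleton 0
    (ContinuousOn.congr (f := fun ξ => (H ξ) ^ (p - 1) • gradient H ξ) ?_ ?_)
  · refine ContinuousOn.smul (hH.contDiffOn.continuousOn.rpow_const ?_)
      ((LinearIsometryEquiv.continuous _).comp_continuousOn hH.continuousOn_fderiv)
    exact fun ξ hξ => Or.inl (hH.pos ξ hξ).ne'
  · intro ξ hξ
    exact if_neg hξ

end IsEllipticFinsler

/-! ### Picone's inequality for the regularized test functions -/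

theorem young_rpow_sub_one {p x y : ℝ} (hp : 1 < p) (hx : 0 ≤ x) (hy : 0 ≤ y) :
    p * (x ^ (p - 1) * y) ≤ (p - 1) * x ^ p + y ^ p := by
  have h := Real.young_inequality_of_nonneg hy (Real.rpow_nonneg hx (p - 1))
    (Real.HolderConjugate.conjExponent hp)
  have hp1 : p - 1 ≠ 0 := by linarith
  rw [← Real.rpow_mul hx, Real.conjExponent, mul_div_cancel₀ _ hp1] at h
  have h2 := mul_le_mul_of_nonneg_left h (by linarith : 0 ≤ p)
  have h3 : p * (y ^ p / p + x ^ p / (p / (p - 1))) = (p - 1) * x ^ p + y ^ p := by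
    field_simp
    ring
  rw [h3] at h2
  linarith [mul_comm y (x ^ (p - 1))]

/-- Picone's inequality with errors. The numbers `k₁, k₂` stand for `H(∇v₁), H(∇v₂)`, the numbers
`m₁₂, m₂₁` for the mixed products of flux and gradient, `τ` for the slope of the truncation of `v₁`,
and `d, h` for the slope and the value of the smoothed positive part of `A ^ p - b ^ p`. The two
errors come from `τ ≠ 1` and from the failure `e` of the smoothed positive part to be linear. -/
theorem picone_regularized {p A b τ d h e δ k₁ k₂ m₁₂ m₂₁ : ℝ} (hp : 1 < p) (hA : 0 < A)
    (hb : 0 < b) (hτ0 : 0 ≤ τ) (hτ1 : τ ≤ 1) (hd0 : 0 ≤ d) (hd1 : d ≤ 1)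
    (hd : A ^ p - b ^ p ≤ 0 → d = 0) (he0 : 0 ≤ e) (heδ : e ≤ δ)
    (hh : h = (A ^ p - b ^ p) * d - e) (hk₁ : 0 ≤ k₁) (hk₂ : 0 ≤ k₂)
    (h₁₂ : m₁₂ ≤ k₁ ^ (p - 1) * k₂) (h₂₁ : m₂₁ ≤ k₂ ^ (p - 1) * k₁) :
    -(p * (1 - τ) * (k₁ ^ (p - 1) * k₂)) - (p - 1) * δ * b ^ (-p) * k₂ ^ p ≤
      ((d * p * τ - (p - 1) * h * τ * A ^ (-p)) * k₁ ^ p + (-(d * p * (b / A) ^ (p - 1))) * m₁₂) -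
      ((d * p * (A / b) ^ (p - 1) * τ) * m₂₁ + (-(d * p) - (p - 1) * h * b ^ (-p)) * k₂ ^ p) := by
  have hp0 : 0 < p := by linarith
  have hp1 : 0 < p - 1 := by linarith
  have Y1 : p * ((b / A) ^ (p - 1) * (k₁ ^ (p - 1) * k₂)) ≤
      (p - 1) * ((b / A) ^ p * k₁ ^ p) + k₂ ^ p := by
    have := young_rpow_sub_one hp (x := b / A * k₁) (y := k₂) (by positivity) hk₂
    rwa [Real.mul_rpow (by positivity) hk₁, Real.mul_rpow (by positivity) hk₁, mul_assoc] at this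
  have Y2 : p * ((A / b) ^ (p - 1) * (k₂ ^ (p - 1) * k₁)) ≤
      (p - 1) * ((A / b) ^ p * k₂ ^ p) + k₁ ^ p := by
    have := young_rpow_sub_one hp (x := A / b * k₂) (y := k₁) (by positivity) hk₁
    rwa [Real.mul_rpow (by positivity) hk₂, Real.mul_rpow (by positivity) hk₂, mul_assoc] at this
  have hr0 : 0 ≤ (b / A) ^ (p - 1) := by positivity
  have hR0 : 0 ≤ (A / b) ^ (p - 1) := by positivity
  have hr : A ^ (-p) * b ^ p = (b / A) ^ p := by
    rw [Real.div_rpow hb.le hA.le, Real.rpow_neg hA.le]; ring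
  have hR : b ^ (-p) * A ^ p = (A / b) ^ p := by
    rw [Real.div_rpow hA.le hb.le, Real.rpow_neg hb.le]; ring
  have hAA : A ^ (-p) * A ^ p = 1 := by rw [← Real.rpow_add hA]; simp
  have hbb : b ^ (-p) * b ^ p = 1 := by rw [← Real.rpow_add hb]; simp
  have hRp : 0 ≤ (A / b) ^ p := by positivity
  have hA0 : 0 ≤ A ^ (-p) := by positivity
  have hb0 : 0 ≤ b ^ (-p) := by positivity
  -- the factor `(b / A) ^ (p - 1)` may be dropped, since `d` vanishes unless `b ≤ A`
  have hdr : d * (b / A) ^ (p - 1) ≤ 1 := by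
    by_cases hw : A ^ p - b ^ p ≤ 0
    · rw [hd hw]; simp
    · have hbA : b ≤ A := by
        by_contra! hlt
        exact hw (by linarith [Real.rpow_le_rpow hA.le hlt.le hp0.le])
      have : (b / A) ^ (p - 1) ≤ 1 :=
        Real.rpow_le_one (by positivity) ((div_le_one hA).2 hbA) hp1.le
      nlinarith
  have hK1 : 0 ≤ k₁ ^ p := by positivity
  have hK2 : 0 ≤ k₂ ^ p := by positivity
  have hM : 0 ≤ k₁ ^ (p - 1) * k₂ := by positivity
  generalize k₁ ^ (p - 1) * k₂ = M₁ at *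
  generalize k₂ ^ (p - 1) * k₁ = M₂ at *
  generalize k₁ ^ p = K₁ at *
  generalize k₂ ^ p = K₂ at *
  generalize (b / A) ^ (p - 1) = r at *
  generalize (A / b) ^ (p - 1) = R at *
  have e1 : h * A ^ (-p) = d * (1 - (b / A) ^ p) - e * A ^ (-p) := by
    rw [hh, ← hr, ← hAA]; ring
  have e2 : h * b ^ (-p) = d * ((A / b) ^ p - 1) - e * b ^ (-p) := by
    rw [hh, ← hR, ← hbb]; ring
  generalize (b / A) ^ p = rp at *
  generalize (A / b) ^ p = Rp at *
  generalize A ^ (-p) = a at *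
  generalize b ^ (-p) = c at *
  have i1 : d * p * r * m₁₂ ≤ d * p * r * M₁ := mul_le_mul_of_nonneg_left h₁₂ (by positivity)
  have i2 : d * p * R * τ * m₂₁ ≤ d * p * R * τ * M₂ :=
    mul_le_mul_of_nonneg_left h₂₁ (by positivity)
  have i3 : d * τ * (p * (r * M₁)) ≤ d * τ * ((p - 1) * (rp * K₁) + K₂) :=
    mul_le_mul_of_nonneg_left Y1 (by positivity)
  have i4 : (1 - τ) * p * M₁ * (d * r) ≤ (1 - τ) * p * M₁ * 1 :=
    mul_le_mul_of_nonneg_left hdr (mul_nonneg (mul_nonneg (by linarith) hp0.le) hM)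
  have i5 : d * τ * (p * (R * M₂)) ≤ d * τ * ((p - 1) * (Rp * K₂) + K₁) :=
    mul_le_mul_of_nonneg_left Y2 (by positivity)
  have i6 : (p - 1) * c * K₂ * e ≤ (p - 1) * c * K₂ * δ :=
    mul_le_mul_of_nonneg_left heδ (by positivity)
  have i7 : 0 ≤ d * (1 - τ) * (1 + (p - 1) * Rp) * K₂ :=
    mul_nonneg (mul_nonneg (mul_nonneg hd0 (by linarith)) (by positivity)) hK2
  have i8 : 0 ≤ (p - 1) * τ * e * a * K₁ := by positivity
  have e1' : (p - 1) * h * τ * a = (p - 1) * τ * (d * (1 - rp) - e * a) := by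
    rw [← e1]; ring
  have e2' : (p - 1) * h * c = (p - 1) * (d * (Rp - 1) - e * c) := by
    rw [← e2]; ring
  rw [e1', e2']
  linarith

/-- A `C¹` approximation of the positive part. -/
noncomputable def softPos (δ w : ℝ) : ℝ := max w 0 ^ 2 / (max w 0 + δ)

/-- The derivative of `softPos δ`. -/
noncomputable def softPosDeriv (δ w : ℝ) : ℝ := 1 - (δ / (max w 0 + δ)) ^ 2

section SoftPos

variable {δ w : ℝ}

theorem softPos_of_nonpos (hw : w ≤ 0) : softPos δ w = 0 := by simp [softPos, hw]

theorem softPosDeriv_of_nonpos (hδ : 0 < δ) (hw : w ≤ 0) : softPosDeriv δ w = 0 := by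
  simp [softPosDeriv, hw, hδ.ne']

theorem softPos_nonneg (hδ : 0 < δ) : 0 ≤ softPos δ w := by
  have := le_max_right w 0
  unfold softPos
  positivity

theorem softPos_le (hδ : 0 < δ) : softPos δ w ≤ max w 0 := by
  have := le_max_right w 0
  unfold softPos
  rw [div_le_iff₀ (by positivity)]
  nlinarith [mul_nonneg this hδ.le]

theorem sub_le_softPos (hδ : 0 < δ) : max w 0 - δ ≤ softPos δ w := by
  have := le_max_right w 0
  unfold softPos
  rw [le_div_iff₀ (by positivity)]
  nlinarith

theorem softPosDeriv_nonneg (hδ : 0 < δ) : 0 ≤ softPosDeriv δ w := by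
  have := le_max_right w 0
  have h1 : δ / (max w 0 + δ) ≤ 1 := (div_le_one (by positivity)).2 (by linarith)
  have h0 : 0 ≤ δ / (max w 0 + δ) := by positivity
  unfold softPosDeriv
  nlinarith

theorem softPosDeriv_le_one : softPosDeriv δ w ≤ 1 := by
  unfold softPosDeriv
  nlinarith [sq_nonneg (δ / (max w 0 + δ))]

theorem mul_softPosDeriv_sub_softPos_mem_Icc (hδ : 0 < δ) :
    w * softPosDeriv δ w - softPos δ w ∈ Icc 0 δ := by
  rcases le_total w 0 with hw | hw
  · simp [softPos_of_nonpos hw, softPosDeriv_of_nonpos hδ hw, hδ.le]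
  · have h : w * softPosDeriv δ w - softPos δ w = δ * (w / (w + δ)) ^ 2 := by
      simp only [softPos, softPosDeriv, max_eq_left hw]
      field_simp
      ring
    rw [h]
    have h1 : w / (w + δ) ≤ 1 := (div_le_one (by positivity)).2 (by linarith)
    have h0 : 0 ≤ w / (w + δ) := by positivity
    exact ⟨by positivity, mul_le_of_le_one_right hδ.le (by nlinarith)⟩

theorem continuous_softPosDeriv (hδ : 0 < δ) : Continuous (softPosDeriv δ) := by
  unfold softPosDeriv
  refine continuous_const.sub ((continuous_const.div (by fun_prop) fun w => ?_).pow 2)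
  have := le_max_right w 0
  positivity

theorem hasDerivAt_softPos (hδ : 0 < δ) (w : ℝ) : HasDerivAt (softPos δ) (softPosDeriv δ w) w := by
  rcases lt_trichotomy w 0 with hw | rfl | hw
  · rw [softPosDeriv_of_nonpos hδ hw.le]
    refine (hasDerivAt_const w (0 : ℝ)).congr_of_eventuallyEq ?_
    filter_upwards [gt_mem_nhds hw] with x hx using softPos_of_nonpos hx.le
  · -- at the origin, the function is quadratically small
    rw [softPosDeriv_of_nonpos hδ le_rfl, hasDerivAt_iff_isLittleO]
    simp only [softPos_of_nonpos le_rfl, sub_zero, smul_zero]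
    have h1 : softPos δ =O[𝓝 0] fun x : ℝ => x ^ 2 := by
      refine Asymptotics.IsBigO.of_bound δ⁻¹ (Eventually.of_forall fun x => ?_)
      have h0 := le_max_right x 0
      have h2 : max x 0 ^ 2 ≤ x ^ 2 := by
        rcases le_total x 0 with h | h <;> simp [h, sq_nonneg]
      rw [Real.norm_of_nonneg (softPos_nonneg hδ), Real.norm_of_nonneg (sq_nonneg x), softPos,
        div_eq_inv_mul]
      exact mul_le_mul (inv_anti₀ hδ (by linarith)) h2 (sq_nonneg _) (by positivity)
    refine h1.trans_isLittleO ?_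
    simpa using Asymptotics.isLittleO_pow_pow (𝕜 := ℝ) (m := 1) (n := 2) (by norm_num)
  · have h1 : HasDerivAt (fun x : ℝ => x ^ 2 / (x + δ)) (softPosDeriv δ w) w := by
      have := ((hasDerivAt_id w).pow 2).div ((hasDerivAt_id w).add_const δ)
        (by simp only [id]; positivity)
      refine this.congr_deriv ?_
      simp only [softPosDeriv, max_eq_left hw.le, id]
      field_simp
      simp
      ring
    refine h1.congr_of_eventuallyEq ?_
    filter_upwards [lt_mem_nhds hw] with x hx
    simp [softPos, hx.le]

theorem contDiff_softPos (hδ : 0 < δ) : ContDiff ℝ 1 (softPos δ) := by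
  rw [contDiff_one_iff_deriv]
  refine ⟨fun w => (hasDerivAt_softPos hδ w).differentiableAt, ?_⟩
  rw [show deriv (softPos δ) = softPosDeriv δ from funext fun w => (hasDerivAt_softPos hδ w).deriv]
  exact continuous_softPosDeriv hδ

end SoftPos

/-! ### Test functions -/

/-- A smooth approximation of the absolute value. -/
noncomputable def softAbs (δ t : ℝ) : ℝ := √(t ^ 2 + δ ^ 2) - δ

section SoftAbs

variable {δ t : ℝ}

theorem softAbs_zero (hδ : 0 < δ) : softAbs δ 0 = 0 := by
  simp [softAbs, Real.sqrt_sq hδ.le]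

theorem softAbs_nonneg (hδ : 0 < δ) : 0 ≤ softAbs δ t :=
  sub_nonneg.2 ((Real.le_sqrt hδ.le (by positivity)).2 (by nlinarith [sq_nonneg t]))

theorem hasDerivAt_softAbs (hδ : 0 < δ) : HasDerivAt (softAbs δ) (t / √(t ^ 2 + δ ^ 2)) t := by
  have h0 : t ^ 2 + δ ^ 2 ≠ 0 := by positivity
  have h := (((hasDerivAt_pow 2 t).add_const (δ ^ 2)).sqrt h0).sub_const δ
  refine h.congr_deriv ?_
  rw [Nat.cast_ofNat, pow_one, mul_div_mul_left _ _ two_ne_zero]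

theorem contDiff_softAbs (hδ : 0 < δ) : ContDiff ℝ 1 (softAbs δ) := by
  refine ContDiff.sub (ContDiff.sqrt (by fun_prop) fun t => ?_) contDiff_const
  positivity

theorem abs_div_sqrt_sq_add_sq_le_one : |t / √(t ^ 2 + δ ^ 2)| ≤ 1 := by
  rw [abs_div, abs_of_nonneg (Real.sqrt_nonneg _)]
  refine div_le_one_of_le₀ (Real.abs_le_sqrt ?_) (Real.sqrt_nonneg _)
  nlinarith [sq_nonneg δ]

theorem tendsto_softAbs {δ t : ℕ → ℝ} {s : ℝ} (hδ : Tendsto δ atTop (𝓝 0))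
    (ht : Tendsto t atTop (𝓝 s)) : Tendsto (fun n => softAbs (δ n) (t n)) atTop (𝓝 |s|) := by
  have := (((ht.pow 2).add (hδ.pow 2)).sqrt).sub hδ
  simpa [softAbs, Real.sqrt_sq_eq_abs] using this

end SoftAbs

section TestFunction

variable {N : ℕ} {Ω : Set (EuclideanSpace ℝ (Fin N))} {φ φ₁ φ₂ f : EuclideanSpace ℝ (Fin N) → ℝ}

theorem gradient_eq_of_hasFDerivAt {a b : ℝ} {x : EuclideanSpace ℝ (Fin N)}
    (h : HasFDerivAt f (a • fderiv ℝ φ₁ x + b • fderiv ℝ φ₂ x) x) :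
    gradient f x = a • gradient φ₁ x + b • gradient φ₂ x := by
  simp [gradient, h.fderiv]

namespace IsTestFunction

theorem one_of_top (hφ : IsTestFunction ⊤ Ω φ) : IsTestFunction 1 Ω φ :=
  ⟨hφ.contDiff.of_le (by exact_mod_cast le_top), hφ.hasCompactSupport, hφ.tsupport_subset⟩

theorem continuous (hφ : IsTestFunction 1 Ω φ) : Continuous φ := hφ.contDiff.continuous

theorem differentiable (hφ : IsTestFunction 1 Ω φ) : Differentiable ℝ φ :=
  hφ.contDiff.differentiable (by simp)

theorem continuous_gradient (hφ : IsTestFunction 1 Ω φ) : Continuous (gradient φ) :=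
  (LinearIsometryEquiv.continuous _).comp (hφ.contDiff.continuous_fderiv (by simp))

theorem of_eq_zero (h₁ : IsTestFunction 1 Ω φ₁) (h₂ : IsTestFunction 1 Ω φ₂)
    (hf : ContDiff ℝ 1 f) (h0 : ∀ x, φ₁ x = 0 → φ₂ x = 0 → f x = 0) : IsTestFunction 1 Ω f := by
  have hK : IsCompact (tsupport φ₁ ∪ tsupport φ₂) :=
    h₁.hasCompactSupport.isCompact.union h₂.hasCompactSupport.isCompact
  have hsub : tsupport f ⊆ tsupport φ₁ ∪ tsupport φ₂ := by
    refine closure_minimal (fun x hx => ?_) hK.isClosed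
    by_contra hx'
    rw [mem_union, not_or] at hx'
    exact hx (h0 x (image_eq_zero_of_notMem_tsupport hx'.1)
      (image_eq_zero_of_notMem_tsupport hx'.2))
  exact ⟨hf, hK.of_isClosed_subset (isClosed_tsupport f) hsub,
    hsub.trans (union_subset h₁.tsupport_subset h₂.tsupport_subset)⟩

theorem softAbs_comp (hφ : IsTestFunction 1 Ω φ) {δ : ℝ} (hδ : 0 < δ) :
    IsTestFunction 1 Ω (fun x => softAbs δ (φ x)) :=
  of_eq_zero hφ hφ ((contDiff_softAbs hδ).comp hφ.contDiff) fun x hx _ => by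
    rw [hx, softAbs_zero hδ]

theorem gradient_softAbs_comp (hφ : IsTestFunction 1 Ω φ) {δ : ℝ} (hδ : 0 < δ)
    (x : EuclideanSpace ℝ (Fin N)) :
    gradient (fun x => softAbs δ (φ x)) x = (φ x / √(φ x ^ 2 + δ ^ 2)) • gradient φ x := by
  have h : HasFDerivAt (fun x => softAbs δ (φ x)) _ x :=
    (hasDerivAt_softAbs hδ).comp_hasFDerivAt x (hφ.differentiable x).hasFDerivAt
  simpa using gradient_eq_of_hasFDerivAt (b := 0) (φ₂ := φ) (h.congr_fderiv (by simp))

theorem sub (h₁ : IsTestFunction 1 Ω φ₁) (h₂ : IsTestFunction 1 Ω φ₂) :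
    IsTestFunction 1 Ω (fun x => φ₁ x - φ₂ x) :=
  of_eq_zero h₁ h₂ (h₁.contDiff.sub h₂.contDiff) fun x hx hx' => by rw [hx, hx', sub_zero]

theorem gradient_sub (h₁ : IsTestFunction 1 Ω φ₁) (h₂ : IsTestFunction 1 Ω φ₂)
    (x : EuclideanSpace ℝ (Fin N)) :
    gradient (fun x => φ₁ x - φ₂ x) x = gradient φ₁ x - gradient φ₂ x := by
  have h := (h₁.differentiable x).hasFDerivAt.fun_sub (h₂.differentiable x).hasFDerivAt
  rw [gradient_eq_of_hasFDerivAt (a := 1) (b := -1) (φ₁ := φ₁) (φ₂ := φ₂)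
    (h.congr_fderiv (by simp [sub_eq_add_neg]))]
  simp [sub_eq_add_neg]

theorem integrableOn_mul (hφ : IsTestFunction 1 Ω φ) {g : EuclideanSpace ℝ (Fin N) → ℝ}
    (hg : LocallyIntegrableOn g Ω) : IntegrableOn (fun x => g x * φ x) Ω := by
  have hK : IsCompact (tsupport φ) := hφ.hasCompactSupport.isCompact
  have h1 : IntegrableOn (fun x => g x * φ x) (tsupport φ) :=
    (hg.integrableOn_compact_subset hφ.tsupport_subset hK).mul_continuousOn
      hφ.continuous.continuousOn hK
  refine (h1.integrable_of_forall_notMem_eq_zero fun x hx => ?_).integrableOn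
  rw [image_eq_zero_of_notMem_tsupport hx, mul_zero]

end IsTestFunction

end TestFunction

/-! ### Testing with limits of test functions -/

/-- A form of Fatou's lemma. -/
theorem lintegral_le_of_ae_tendsto {α : Type*} [MeasurableSpace α] {μ : Measure α}
    {f : ℕ → α → ENNReal} {F : α → ENNReal} {B : ℕ → ENNReal} {b : ENNReal}
    (hf : ∀ n, AEMeasurable (f n) μ) (h : ∀ᵐ x ∂μ, Tendsto (fun n => f n x) atTop (𝓝 (F x)))
    (hB : ∀ n, ∫⁻ x, f n x ∂μ ≤ B n) (hb : Tendsto B atTop (𝓝 b)) : ∫⁻ x, F x ∂μ ≤ b :=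
  calc ∫⁻ x, F x ∂μ = ∫⁻ x, liminf (fun n => f n x) atTop ∂μ :=
        lintegral_congr_ae (h.mono fun _ hx => hx.liminf_eq.symm)
    _ ≤ liminf (fun n => ∫⁻ x, f n x ∂μ) atTop := lintegral_liminf_le' hf
    _ ≤ liminf B atTop := liminf_le_liminf (Eventually.of_forall hB)
    _ = b := hb.liminf_eq

/-- `-div Y = g` in `Ω`, tested with `C¹_c(Ω)`, with a nonnegative locally integrable `g`. -/
structure IsNonnegDivergence {N : ℕ} (Ω : Set (EuclideanSpace ℝ (Fin N)))
    (g : EuclideanSpace ℝ (Fin N) → ℝ) (Y : EuclideanSpace ℝ (Fin N) → EuclideanSpace ℝ (Fin N)) :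
    Prop where
  nonneg : ∀ᵐ x ∂(volume.restrict Ω), 0 ≤ g x
  locallyIntegrableOn : LocallyIntegrableOn g Ω
  aestronglyMeasurable : AEStronglyMeasurable Y (volume.restrict Ω)
  integral_eq : ∀ φ, IsTestFunction 1 Ω φ →
    ∫ x in Ω, inner ℝ (Y x) (gradient φ x) = ∫ x in Ω, g x * φ x

/-- The test functions `φ n` converge to `ψ` almost everywhere in `Ω` and their gradients converge
to `Ψ` in the space `L¹` with weight `|w|`. -/
structure IsTestLimit {N : ℕ} (Ω : Set (EuclideanSpace ℝ (Fin N)))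
    (w : EuclideanSpace ℝ (Fin N) → ℝ) (φ : ℕ → EuclideanSpace ℝ (Fin N) → ℝ)
    (ψ : EuclideanSpace ℝ (Fin N) → ℝ) (Ψ : EuclideanSpace ℝ (Fin N) → EuclideanSpace ℝ (Fin N)) :
    Prop where
  isTestFunction : ∀ n, IsTestFunction 1 Ω (φ n)
  tendsto : ∀ᵐ x ∂(volume.restrict Ω), Tendsto (fun n => φ n x) atTop (𝓝 (ψ x))
  aestronglyMeasurable : AEStronglyMeasurable Ψ (volume.restrict Ω)
  lintegral_ne_top : ∫⁻ x in Ω, ‖w x‖ₑ * ‖Ψ x‖ₑ ≠ ⊤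
  tendsto_lintegral :
    Tendsto (fun n => ∫⁻ x in Ω, ‖w x‖ₑ * ‖gradient (φ n) x - Ψ x‖ₑ) atTop (𝓝 0)

section

variable {N : ℕ} {Ω : Set (EuclideanSpace ℝ (Fin N))} {g w : EuclideanSpace ℝ (Fin N) → ℝ}
  {Y : EuclideanSpace ℝ (Fin N) → EuclideanSpace ℝ (Fin N)}

theorem tendsto_one_div_succ : Tendsto (fun n : ℕ => 1 / ((n : ℝ) + 1)) atTop (𝓝 0) :=
  tendsto_one_div_add_atTop_nhds_zero_nat

theorem enorm_inner_le (u v : EuclideanSpace ℝ (Fin N)) : ‖inner ℝ u v‖ₑ ≤ ‖u‖ₑ * ‖v‖ₑ := by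
  simp only [← ofReal_norm]
  rw [← ENNReal.ofReal_mul (norm_nonneg _)]
  exact ENNReal.ofReal_le_ofReal (norm_inner_le_norm _ _)

/-- Testing with a smoothed `|φ|` makes the functional `φ ↦ ∫ gφ` bounded by the gradient alone. -/
theorem IsNonnegDivergence.lintegral_enorm_mul_le (hY : IsNonnegDivergence Ω g Y)
    {φ : EuclideanSpace ℝ (Fin N) → ℝ} (hφ : IsTestFunction 1 Ω φ) :
    ∫⁻ x in Ω, ‖g x * φ x‖ₑ ≤ ∫⁻ x in Ω, ‖Y x‖ₑ * ‖gradient φ x‖ₑ := by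
  have hη : ∀ n : ℕ, 0 < 1 / ((n : ℝ) + 1) := fun n => Nat.one_div_pos_of_nat
  have hβ := fun n => hφ.softAbs_comp (hη n)
  have hint := fun n => (hβ n).integrableOn_mul hY.locallyIntegrableOn
  have hlim : ∀ x, Tendsto (fun n : ℕ => ‖g x * softAbs (1 / ((n : ℝ) + 1)) (φ x)‖ₑ) atTop
      (𝓝 ‖g x * φ x‖ₑ) := by
    intro x
    have h := ((tendsto_softAbs tendsto_one_div_succ
      (tendsto_const_nhds (x := φ x))).const_mul (g x)).enorm
    simpa [enorm_mul, ← ofReal_norm] using h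
  refine lintegral_le_of_ae_tendsto (fun n => (hint n).aestronglyMeasurable.enorm)
    (ae_of_all _ hlim) (fun n => ?_) tendsto_const_nhds
  have h0 : 0 ≤ᵐ[volume.restrict Ω] fun x => g x * softAbs (1 / ((n : ℝ) + 1)) (φ x) := by
    filter_upwards [hY.nonneg] with x hx using mul_nonneg hx (softAbs_nonneg (hη n))
  calc ∫⁻ x in Ω, ‖g x * softAbs (1 / ((n : ℝ) + 1)) (φ x)‖ₑ
      = ∫⁻ x in Ω, ENNReal.ofReal (g x * softAbs (1 / ((n : ℝ) + 1)) (φ x)) :=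
        lintegral_congr_ae (h0.mono fun x hx => Real.enorm_of_nonneg hx)
    _ = ENNReal.ofReal (∫ x in Ω, g x * softAbs (1 / ((n : ℝ) + 1)) (φ x)) :=
        (ofReal_integral_eq_lintegral_ofReal (hint n) h0).symm
    _ = ‖∫ x in Ω, inner ℝ (Y x) (gradient (fun x => softAbs (1 / ((n : ℝ) + 1)) (φ x)) x)‖ₑ := by
        rw [hY.integral_eq _ (hβ n), Real.enorm_of_nonneg (integral_nonneg_of_ae h0)]
    _ ≤ ∫⁻ x in Ω, ‖inner ℝ (Y x) (gradient (fun x => softAbs (1 / ((n : ℝ) + 1)) (φ x)) x)‖ₑ :=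
        enorm_integral_le_lintegral_enorm _
    _ ≤ ∫⁻ x in Ω, ‖Y x‖ₑ * ‖gradient φ x‖ₑ := by
        refine lintegral_mono fun x => ?_
        rw [hφ.gradient_softAbs_comp (hη n)]
        refine (enorm_inner_le _ _).trans (mul_le_mul_right (enorm_le_iff_norm_le.2 ?_) _)
        rw [norm_smul]
        exact mul_le_of_le_one_left (norm_nonneg _) abs_div_sqrt_sq_add_sq_le_one

theorem IsTestLimit.integrableOn_inner {φ : ℕ → EuclideanSpace ℝ (Fin N) → ℝ}
    {ψ : EuclideanSpace ℝ (Fin N) → ℝ} {Ψ : EuclideanSpace ℝ (Fin N) → EuclideanSpace ℝ (Fin N)}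
    (h : IsTestLimit Ω w φ ψ Ψ) (hYm : AEStronglyMeasurable Y (volume.restrict Ω))
    (hw : ∀ x, ‖Y x‖ ≤ w x) : IntegrableOn (fun x => inner ℝ (Y x) (Ψ x)) Ω := by
  refine ⟨hYm.inner h.aestronglyMeasurable, lt_of_le_of_lt ?_ h.lintegral_ne_top.lt_top⟩
  refine lintegral_mono fun x => (enorm_inner_le _ _).trans ?_
  gcongr
  exact enorm_le_iff_norm_le.2 ((hw x).trans (le_abs_self _))

end

theorem aemeasurable_enorm_mul_enorm {α F F' : Type*} [MeasurableSpace α] {μ : Measure α}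
    [NormedAddCommGroup F] [NormedAddCommGroup F'] {w : α → F} {X : α → F'}
    (hw : AEStronglyMeasurable w μ) (hX : AEStronglyMeasurable X μ) :
    AEMeasurable (fun x => ‖w x‖ₑ * ‖X x‖ₑ) μ :=
  hw.enorm.mul hX.enorm

section

variable {N : ℕ} {Ω : Set (EuclideanSpace ℝ (Fin N))} {g w : EuclideanSpace ℝ (Fin N) → ℝ}
  {Y : EuclideanSpace ℝ (Fin N) → EuclideanSpace ℝ (Fin N)}

/-- The weak formulation extends to limits of test functions. By
`IsNonnegDivergence.lintegral_enorm_mul_le`, the sequence `g * φ n` is Cauchy in `L¹`, although `g`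
is only locally integrable. -/
theorem IsNonnegDivergence.integral_eq_of_isTestLimit (hY : IsNonnegDivergence Ω g Y)
    (hw : ∀ x, ‖Y x‖ ≤ w x) {φ : ℕ → EuclideanSpace ℝ (Fin N) → ℝ}
    {ψ : EuclideanSpace ℝ (Fin N) → ℝ} {Ψ : EuclideanSpace ℝ (Fin N) → EuclideanSpace ℝ (Fin N)}
    (h : IsTestLimit Ω w φ ψ Ψ) :
    IntegrableOn (fun x => g x * ψ x) Ω ∧
      ∫ x in Ω, inner ℝ (Y x) (Ψ x) = ∫ x in Ω, g x * ψ x := by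
  have hgm := hY.locallyIntegrableOn.aestronglyMeasurable
  have hYm := hY.aestronglyMeasurable
  have hφm : ∀ n, AEStronglyMeasurable (φ n) (volume.restrict Ω) := fun n =>
    (h.isTestFunction n).continuous.aestronglyMeasurable
  have hψm : AEStronglyMeasurable ψ (volume.restrict Ω) :=
    aestronglyMeasurable_of_tendsto_ae atTop hφm h.tendsto
  have hDm : ∀ n, AEStronglyMeasurable (fun x => gradient (φ n) x - Ψ x) (volume.restrict Ω) :=
    fun n => (h.isTestFunction n).continuous_gradient.aestronglyMeasurable.sub
      h.aestronglyMeasurable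
  have hwe : ∀ x, ‖Y x‖ₑ ≤ ‖w x‖ₑ := fun x =>
    enorm_le_iff_norm_le.2 ((hw x).trans (le_abs_self _))
  set e : ℕ → ENNReal := fun n => ∫⁻ x in Ω, ‖w x‖ₑ * ‖gradient (φ n) x - Ψ x‖ₑ
  have hYe : ∀ n, ∫⁻ x in Ω, ‖Y x‖ₑ * ‖gradient (φ n) x - Ψ x‖ₑ ≤ e n := fun n =>
    lintegral_mono fun x => mul_le_mul_left (hwe x) _
  have hcauchy : ∀ n m, ∫⁻ x in Ω, ‖g x * (φ n x - φ m x)‖ₑ ≤ e n + e m := by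
    intro n m
    refine (hY.lintegral_enorm_mul_le ((h.isTestFunction n).sub (h.isTestFunction m))).trans ?_
    refine le_trans ?_ (add_le_add (hYe n) (hYe m))
    rw [← lintegral_add_left' (aemeasurable_enorm_mul_enorm hYm (hDm n))]
    refine lintegral_mono fun x => ?_
    rw [(h.isTestFunction n).gradient_sub (h.isTestFunction m), ← mul_add,
      ← sub_sub_sub_cancel_right _ _ (Ψ x)]
    exact mul_le_mul_right enorm_sub_le _
  have hL1 : ∀ n, ∫⁻ x in Ω, ‖g x * φ n x - g x * ψ x‖ₑ ≤ e n := by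
    intro n
    refine lintegral_le_of_ae_tendsto (f := fun m x => ‖g x * (φ n x - φ m x)‖ₑ)
      (fun m => (hgm.mul ((hφm n).sub (hφm m))).enorm) ?_ (hcauchy n)
      (by simpa using tendsto_const_nhds.add h.tendsto_lintegral)
    filter_upwards [h.tendsto] with x hx
    rw [← mul_sub]
    exact ((tendsto_const_nhds.sub hx).const_mul (g x)).enorm
  have hint : ∀ n, IntegrableOn (fun x => g x * φ n x) Ω := fun n =>
    (h.isTestFunction n).integrableOn_mul hY.locallyIntegrableOn
  have hgψ : IntegrableOn (fun x => g x * ψ x) Ω := by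
    obtain ⟨n, hn⟩ := (h.tendsto_lintegral.eventually_lt_const ENNReal.zero_lt_top).exists
    have h1 : IntegrableOn (fun x => g x * φ n x - g x * ψ x) Ω :=
      ⟨(hgm.mul (hφm n)).sub (hgm.mul hψm), (hL1 n).trans_lt hn⟩
    refine (Integrable.sub (hint n) h1).congr (ae_of_all _ fun x => ?_)
    simp
  refine ⟨hgψ, ?_⟩
  have t1 : Tendsto (fun n => ∫ x in Ω, g x * φ n x) atTop (𝓝 (∫ x in Ω, g x * ψ x)) :=
    tendsto_integral_of_L1 _ hgψ.aestronglyMeasurable (Eventually.of_forall hint)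
      (tendsto_of_tendsto_of_tendsto_of_le_of_le tendsto_const_nhds h.tendsto_lintegral
        (fun _ => zero_le) hL1)
  have hiΨ := h.integrableOn_inner hYm hw
  have hL1' : Tendsto
      (fun n => ∫⁻ x in Ω, ‖inner ℝ (Y x) (gradient (φ n) x) - inner ℝ (Y x) (Ψ x)‖ₑ)
      atTop (𝓝 0) := by
    refine tendsto_of_tendsto_of_tendsto_of_le_of_le tendsto_const_nhds h.tendsto_lintegral
        (fun _ => zero_le) fun n => le_trans (lintegral_mono fun x => ?_) (hYe n)
    rw [← inner_sub_right]
    exact enorm_inner_le _ _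
  have t2 : Tendsto (fun n => ∫ x in Ω, inner ℝ (Y x) (gradient (φ n) x)) atTop
      (𝓝 (∫ x in Ω, inner ℝ (Y x) (Ψ x))) := by
    refine tendsto_integral_of_L1 _ hiΨ.aestronglyMeasurable ?_ hL1'
    filter_upwards [hL1'.eventually_lt_const ENNReal.zero_lt_top] with n hn
    have hm := hYm.inner (𝕜 := ℝ)
      (h.isTestFunction n).continuous_gradient.aestronglyMeasurable
    have h1 : IntegrableOn
        (fun x => inner ℝ (Y x) (gradient (φ n) x) - inner ℝ (Y x) (Ψ x)) Ω :=
      ⟨hm.sub hiΨ.aestronglyMeasurable, hn⟩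
    refine (Integrable.add h1 hiΨ).congr (ae_of_all _ fun x => ?_)
    simp
  refine tendsto_nhds_unique t2 (t1.congr fun n => ?_)
  rw [hY.integral_eq _ (h.isTestFunction n)]

theorem enorm_le_ofReal_of_abs_le {c C : ℝ} (h : |c| ≤ C) : ‖c‖ₑ ≤ ENNReal.ofReal C := by
  rw [← ofReal_norm]
  exact ENNReal.ofReal_le_ofReal h

/-- Multiplication by bounded, almost everywhere convergent coefficients preserves convergence in
weighted `L¹`. -/
theorem tendsto_lintegral_enorm_smul_sub {α F : Type*} [MeasurableSpace α] {μ : Measure α}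
    [NormedAddCommGroup F] [NormedSpace ℝ F] {w : α → ℝ} {X : ℕ → α → F} {Z : α → F}
    {c : ℕ → α → ℝ} {b : α → ℝ} {C : ℝ} (hw : AEStronglyMeasurable w μ)
    (hX : ∀ n, AEStronglyMeasurable (X n) μ) (hZ : AEStronglyMeasurable Z μ)
    (hc : ∀ n, AEStronglyMeasurable (c n) μ) (hC : ∀ n x, |c n x| ≤ C)
    (hcb : ∀ᵐ x ∂μ, Tendsto (fun n => c n x) atTop (𝓝 (b x)))
    (hwZ : ∫⁻ x, ‖w x‖ₑ * ‖Z x‖ₑ ∂μ ≠ ⊤)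
    (hXZ : Tendsto (fun n => ∫⁻ x, ‖w x‖ₑ * ‖X n x - Z x‖ₑ ∂μ) atTop (𝓝 0)) :
    Tendsto (fun n => ∫⁻ x, ‖w x‖ₑ * ‖c n x • X n x - b x • Z x‖ₑ ∂μ) atTop (𝓝 0) := by
  have hb : AEStronglyMeasurable b μ := aestronglyMeasurable_of_tendsto_ae atTop hc hcb
  have t1 : Tendsto (fun n => ENNReal.ofReal C * ∫⁻ x, ‖w x‖ₑ * ‖X n x - Z x‖ₑ ∂μ)
      atTop (𝓝 0) := by
    simpa using ENNReal.Tendsto.const_mul hXZ (Or.inr (ENNReal.ofReal_ne_top (r := C)))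
  have t2 : Tendsto (fun n => ∫⁻ x, ‖c n x - b x‖ₑ * (‖w x‖ₑ * ‖Z x‖ₑ) ∂μ) atTop (𝓝 0) := by
    have := tendsto_lintegral_of_dominated_convergence' (μ := μ)
      (F := fun n x => ‖c n x - b x‖ₑ * (‖w x‖ₑ * ‖Z x‖ₑ)) (f := fun _ => 0)
      (fun x => ENNReal.ofReal (2 * C) * (‖w x‖ₑ * ‖Z x‖ₑ))
      (fun n => ((hc n).sub hb).enorm.mul (hw.enorm.mul hZ.enorm)) ?_ ?_ ?_
    · simpa using this
    · intro n
      filter_upwards [hcb] with x hx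
      refine mul_le_mul_left (enorm_le_ofReal_of_abs_le ?_) _
      have h1 : |b x| ≤ C := le_of_tendsto hx.abs (Eventually.of_forall fun n => hC n x)
      linarith [abs_sub (c n x) (b x), hC n x]
    · rw [lintegral_const_mul' _ _ ENNReal.ofReal_ne_top]
      exact ENNReal.mul_ne_top ENNReal.ofReal_ne_top hwZ
    · have hfin : ∀ᵐ x ∂μ, ‖w x‖ₑ * ‖Z x‖ₑ < ⊤ :=
        ae_lt_top' (hw.enorm.mul hZ.enorm) hwZ
      filter_upwards [hcb, hfin] with x hx hx'
      have h1 : Tendsto (fun n => ‖c n x - b x‖ₑ) atTop (𝓝 0) := by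
        simpa using (hx.sub_const (b x)).enorm
      simpa using ENNReal.Tendsto.mul_const h1 (Or.inr hx'.ne)
  have t3 := t1.add t2
  rw [add_zero] at t3
  refine tendsto_of_tendsto_of_tendsto_of_le_of_le tendsto_const_nhds t3 (fun _ => zero_le)
    fun n => ?_
  rw [← lintegral_const_mul' _ _ ENNReal.ofReal_ne_top, ← lintegral_add_left'
    (f := fun x => ENNReal.ofReal C * (‖w x‖ₑ * ‖X n x - Z x‖ₑ))
    ((aemeasurable_enorm_mul_enorm hw ((hX n).sub hZ)).const_mul _)]
  refine lintegral_mono fun x => ?_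
  have h1 : c n x • X n x - b x • Z x = c n x • (X n x - Z x) + (c n x - b x) • Z x := by module
  calc ‖w x‖ₑ * ‖c n x • X n x - b x • Z x‖ₑ
      ≤ ‖w x‖ₑ * (‖c n x‖ₑ * ‖X n x - Z x‖ₑ + ‖c n x - b x‖ₑ * ‖Z x‖ₑ) := by
        rw [h1]
        refine mul_le_mul_right ((enorm_add_le _ _).trans_eq ?_) _
        rw [enorm_smul, enorm_smul]
    _ = ‖c n x‖ₑ * (‖w x‖ₑ * ‖X n x - Z x‖ₑ) + ‖c n x - b x‖ₑ * (‖w x‖ₑ * ‖Z x‖ₑ) := by ring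
    _ ≤ _ := by gcongr; exact enorm_le_ofReal_of_abs_le (hC n x)

/-- The chain rule for limits of test functions: if test functions `Φ n` have gradients that are
combinations of those of `φ₁ n` and `φ₂ n` with bounded convergent coefficients, then so does their
limit. -/
theorem IsTestLimit.of_gradient_eq (hw : AEStronglyMeasurable w (volume.restrict Ω))
    {φ₁ φ₂ Φ : ℕ → EuclideanSpace ℝ (Fin N) → ℝ} {v₁ v₂ ψ : EuclideanSpace ℝ (Fin N) → ℝ}
    {V₁ V₂ : EuclideanSpace ℝ (Fin N) → EuclideanSpace ℝ (Fin N)}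
    (h₁ : IsTestLimit Ω w φ₁ v₁ V₁) (h₂ : IsTestLimit Ω w φ₂ v₂ V₂)
    {a b : ℕ → EuclideanSpace ℝ (Fin N) → ℝ} {a' b' : EuclideanSpace ℝ (Fin N) → ℝ} {C : ℝ}
    (hΦ : ∀ n, IsTestFunction 1 Ω (Φ n))
    (hgrad : ∀ n x, gradient (Φ n) x = a n x • gradient (φ₁ n) x + b n x • gradient (φ₂ n) x)
    (hψ : ∀ᵐ x ∂(volume.restrict Ω), Tendsto (fun n => Φ n x) atTop (𝓝 (ψ x)))
    (ha : ∀ n, AEStronglyMeasurable (a n) (volume.restrict Ω))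
    (hb : ∀ n, AEStronglyMeasurable (b n) (volume.restrict Ω))
    (haC : ∀ n x, |a n x| ≤ C) (hbC : ∀ n x, |b n x| ≤ C)
    (haa : ∀ᵐ x ∂(volume.restrict Ω), Tendsto (fun n => a n x) atTop (𝓝 (a' x)))
    (hbb : ∀ᵐ x ∂(volume.restrict Ω), Tendsto (fun n => b n x) atTop (𝓝 (b' x))) :
    IsTestLimit Ω w Φ ψ (fun x => a' x • V₁ x + b' x • V₂ x) := by
  have ha' : AEStronglyMeasurable a' (volume.restrict Ω) :=
    aestronglyMeasurable_of_tendsto_ae atTop ha haa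
  have hb' : AEStronglyMeasurable b' (volume.restrict Ω) :=
    aestronglyMeasurable_of_tendsto_ae atTop hb hbb
  have hV₁ := h₁.aestronglyMeasurable
  have hV₂ := h₂.aestronglyMeasurable
  have hX₁ := fun n => (h₁.isTestFunction n).continuous_gradient.aestronglyMeasurable
    (μ := volume.restrict Ω)
  have hX₂ := fun n => (h₂.isTestFunction n).continuous_gradient.aestronglyMeasurable
    (μ := volume.restrict Ω)
  refine ⟨hΦ, hψ, (ha'.smul hV₁).add (hb'.smul hV₂), ?_, ?_⟩
  · have h1 : ∫⁻ x in Ω, ‖w x‖ₑ * ‖a' x • V₁ x + b' x • V₂ x‖ₑ ≤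
        ENNReal.ofReal C * (∫⁻ x in Ω, ‖w x‖ₑ * ‖V₁ x‖ₑ) +
          ENNReal.ofReal C * ∫⁻ x in Ω, ‖w x‖ₑ * ‖V₂ x‖ₑ := by
      rw [← lintegral_const_mul' _ _ ENNReal.ofReal_ne_top,
        ← lintegral_const_mul' _ _ ENNReal.ofReal_ne_top,
        ← lintegral_add_left' ((aemeasurable_enorm_mul_enorm hw hV₁).const_mul _)]
      refine lintegral_mono_ae ?_
      filter_upwards [haa, hbb] with x hax hbx
      have h1 : |a' x| ≤ C := le_of_tendsto hax.abs (Eventually.of_forall fun n => haC n x)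
      have h2 : |b' x| ≤ C := le_of_tendsto hbx.abs (Eventually.of_forall fun n => hbC n x)
      calc ‖w x‖ₑ * ‖a' x • V₁ x + b' x • V₂ x‖ₑ
          ≤ ‖w x‖ₑ * (‖a' x‖ₑ * ‖V₁ x‖ₑ + ‖b' x‖ₑ * ‖V₂ x‖ₑ) := by
            refine mul_le_mul_right ((enorm_add_le _ _).trans_eq ?_) _
            rw [enorm_smul, enorm_smul]
        _ = ‖a' x‖ₑ * (‖w x‖ₑ * ‖V₁ x‖ₑ) + ‖b' x‖ₑ * (‖w x‖ₑ * ‖V₂ x‖ₑ) := by ring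
        _ ≤ _ := by
            gcongr
            exacts [enorm_le_ofReal_of_abs_le h1, enorm_le_ofReal_of_abs_le h2]
    refine ne_top_of_le_ne_top ?_ h1
    exact ENNReal.add_ne_top.2 ⟨ENNReal.mul_ne_top ENNReal.ofReal_ne_top h₁.lintegral_ne_top,
      ENNReal.mul_ne_top ENNReal.ofReal_ne_top h₂.lintegral_ne_top⟩
  · have t1 := tendsto_lintegral_enorm_smul_sub hw hX₁ hV₁ ha haC haa h₁.lintegral_ne_top
      h₁.tendsto_lintegral
    have t2 := tendsto_lintegral_enorm_smul_sub hw hX₂ hV₂ hb hbC hbb h₂.lintegral_ne_top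
      h₂.tendsto_lintegral
    have t3 := t1.add t2
    rw [add_zero] at t3
    refine tendsto_of_tendsto_of_tendsto_of_le_of_le tendsto_const_nhds t3 (fun _ => zero_le)
      fun n => ?_
    rw [← lintegral_add_left' (f := fun x => ‖w x‖ₑ * ‖a n x • gradient (φ₁ n) x - a' x • V₁ x‖ₑ)
      (aemeasurable_enorm_mul_enorm hw (((ha n).smul (hX₁ n)).sub (ha'.smul hV₁)))]
    refine lintegral_mono fun x => ?_
    rw [hgrad, add_sub_add_comm, ← mul_add]
    exact mul_le_mul_right (enorm_add_le _ _) _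

/-- A function of `W₀^{1,p}(Ω)` that is positive almost everywhere is a limit of nonnegative test
functions. -/
theorem MemSobolevZero.exists_isTestLimit {p : ℝ} (hp : 1 < p)
    {v : EuclideanSpace ℝ (Fin N) → ℝ} {V : EuclideanSpace ℝ (Fin N) → EuclideanSpace ℝ (Fin N)}
    (hv : MemSobolevZero p Ω v V) (hpos : ∀ᵐ x ∂(volume.restrict Ω), 0 < v x)
    (hw : MemLp w (ENNReal.ofReal p / ENNReal.ofReal (p - 1)) (volume.restrict Ω)) :
    ∃ φ : ℕ → EuclideanSpace ℝ (Fin N) → ℝ, (∀ n x, 0 ≤ φ n x) ∧ IsTestLimit Ω w φ v V := by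
  obtain ⟨φ, hφ, hφv, hφV⟩ := hv.approx
  have hwm := hw.aestronglyMeasurable
  have hp0 : ENNReal.ofReal p ≠ 0 := by simp; linarith
  have htri : ENNReal.HolderTriple (ENNReal.ofReal p / ENNReal.ofReal (p - 1))
      (ENNReal.ofReal p) 1 := by
    have h1 : 0 < p - 1 := by linarith
    have h2 : 0 < p := by linarith
    constructor
    rw [← ENNReal.ofReal_div_of_pos h1, ← ENNReal.ofReal_inv_of_pos (by positivity),
      ← ENNReal.ofReal_inv_of_pos h2, ← ENNReal.ofReal_add (by positivity) (by positivity),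
      inv_one, ENNReal.ofReal_eq_one]
    field_simp
    ring
  have hholder : ∀ X : EuclideanSpace ℝ (Fin N) → EuclideanSpace ℝ (Fin N),
      AEStronglyMeasurable X (volume.restrict Ω) → ∫⁻ x in Ω, ‖w x‖ₑ * ‖X x‖ₑ ≤
        eLpNorm w (ENNReal.ofReal p / ENNReal.ofReal (p - 1)) (volume.restrict Ω) *
          eLpNorm X (ENNReal.ofReal p) (volume.restrict Ω) := by
    intro X hX
    have := eLpNorm_smul_le_mul_eLpNorm (p := ENNReal.ofReal p / ENNReal.ofReal (p - 1))
      (q := ENNReal.ofReal p) (r := 1) hX hwm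
    rw [eLpNorm_one_eq_lintegral_enorm] at this
    simpa [enorm_smul] using this
  obtain ⟨ns, hns, hae⟩ := (tendstoInMeasure_of_tendsto_eLpNorm (f := φ) (g := v) hp0
    (fun n => (hφ n).one_of_top.continuous.aestronglyMeasurable) hv.memLp.1
    (hφv.congr fun n => eLpNorm_sub_comm v (φ n) _ _)).exists_seq_tendsto_ae
  have h1 : IsTestLimit Ω w (fun n => φ (ns n)) v V := by
    refine ⟨fun n => (hφ _).one_of_top, hae, hv.memLp_grad.1, ?_, ?_⟩
    · exact ne_top_of_le_ne_top (ENNReal.mul_ne_top hw.2.ne hv.memLp_grad.2.ne)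
        (hholder V hv.memLp_grad.1)
    · have t1 := ENNReal.Tendsto.const_mul (hφV.comp hns.tendsto_atTop) (Or.inr hw.2.ne)
      rw [mul_zero] at t1
      refine tendsto_of_tendsto_of_tendsto_of_le_of_le tendsto_const_nhds t1 (fun _ => zero_le)
        fun n => ?_
      refine le_trans (le_of_eq ?_) (hholder (fun x => V x - gradient (φ (ns n)) x)
        (hv.memLp_grad.1.sub (hφ _).one_of_top.continuous_gradient.aestronglyMeasurable))
      simp only [enorm_sub_rev (V _)]
  have hη : ∀ n : ℕ, 0 < 1 / ((n : ℝ) + 1) := fun n => Nat.one_div_pos_of_nat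
  refine ⟨fun n x => softAbs (1 / ((n : ℝ) + 1)) (φ (ns n) x), fun n x => softAbs_nonneg (hη n), ?_⟩
  have h2 := IsTestLimit.of_gradient_eq hwm h1 h1
    (Φ := fun n x => softAbs (1 / ((n : ℝ) + 1)) (φ (ns n) x)) (ψ := v) (C := 1)
    (a := fun n x => φ (ns n) x / √(φ (ns n) x ^ 2 + (1 / ((n : ℝ) + 1)) ^ 2)) (b := fun _ _ => 0)
    (a' := fun _ => 1) (b' := fun _ => 0)
    (fun n => (h1.isTestFunction n).softAbs_comp (hη n))
    (fun n x => by rw [(h1.isTestFunction n).gradient_softAbs_comp (hη n)]; simp)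
    ?_ (fun n => ?_) (fun n => aestronglyMeasurable_const)
    (fun n x => abs_div_sqrt_sq_add_sq_le_one) (by simp) ?_ (by simp)
  · simpa using h2
  · filter_upwards [h1.tendsto, hpos] with x hx hx0
    simpa [abs_of_pos hx0] using tendsto_softAbs tendsto_one_div_succ hx
  · have hc := (h1.isTestFunction n).continuous
    refine (Continuous.div hc (by fun_prop) fun x => ?_).aestronglyMeasurable
    have := hη n
    positivity
  · filter_upwards [h1.tendsto, hpos] with x hx hx0
    have h3 : Tendsto (fun n => φ (ns n) x / √(φ (ns n) x ^ 2 + (1 / ((n : ℝ) + 1)) ^ 2)) atTop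
        (𝓝 (v x / √(v x ^ 2 + 0 ^ 2))) :=
      hx.div ((hx.pow 2).add (tendsto_one_div_succ.pow 2)).sqrt (by
        rw [zero_pow two_ne_zero, add_zero, Real.sqrt_sq hx0.le]
        exact hx0.ne')
    rwa [zero_pow two_ne_zero, add_zero, Real.sqrt_sq hx0.le, div_self hx0.ne'] at h3

end

/-- The chain rule in `IsTestLimit` for a function `F` of two variables with bounded partial
derivatives `a`, `b` on the quadrant. -/
theorem IsTestLimit.comp {N : ℕ} {Ω : Set (EuclideanSpace ℝ (Fin N))}
    {w : EuclideanSpace ℝ (Fin N) → ℝ} (hw : AEStronglyMeasurable w (volume.restrict Ω))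
    {φ₁ φ₂ : ℕ → EuclideanSpace ℝ (Fin N) → ℝ} {v₁ v₂ : EuclideanSpace ℝ (Fin N) → ℝ}
    {V₁ V₂ : EuclideanSpace ℝ (Fin N) → EuclideanSpace ℝ (Fin N)}
    (h₁ : IsTestLimit Ω w φ₁ v₁ V₁) (h₂ : IsTestLimit Ω w φ₂ v₂ V₂)
    (hφ₁ : ∀ n x, 0 ≤ φ₁ n x) (hφ₂ : ∀ n x, 0 ≤ φ₂ n x) {F a b : ℝ × ℝ → ℝ} {C : ℝ}
    (hF0 : F 0 = 0) (hF : ∀ q ∈ Ici (0 : ℝ × ℝ), ContDiffAt ℝ 1 F q)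
    (hF' : ∀ q ∈ Ici (0 : ℝ × ℝ), HasFDerivAt F
      (a q • ContinuousLinearMap.fst ℝ ℝ ℝ + b q • ContinuousLinearMap.snd ℝ ℝ ℝ) q)
    (ha : ContinuousOn a (Ici 0)) (hb : ContinuousOn b (Ici 0))
    (haC : ∀ q ∈ Ici (0 : ℝ × ℝ), |a q| ≤ C) (hbC : ∀ q ∈ Ici (0 : ℝ × ℝ), |b q| ≤ C) :
    IsTestLimit Ω w (fun n x => F (φ₁ n x, φ₂ n x)) (fun x => F (v₁ x, v₂ x))
      (fun x => a (v₁ x, v₂ x) • V₁ x + b (v₁ x, v₂ x) • V₂ x) := by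
  have hmem : ∀ n x, (φ₁ n x, φ₂ n x) ∈ Ici (0 : ℝ × ℝ) := fun n x => ⟨hφ₁ n x, hφ₂ n x⟩
  have hlim : ∀ {G : ℝ × ℝ → ℝ}, ContinuousOn G (Ici 0) → ∀ᵐ x ∂(volume.restrict Ω),
      Tendsto (fun n => G (φ₁ n x, φ₂ n x)) atTop (𝓝 (G (v₁ x, v₂ x))) := by
    intro G hG
    filter_upwards [h₁.tendsto, h₂.tendsto] with x hx₁ hx₂
    have hv : (v₁ x, v₂ x) ∈ Ici (0 : ℝ × ℝ) :=
      ⟨ge_of_tendsto' hx₁ fun n => hφ₁ n x, ge_of_tendsto' hx₂ fun n => hφ₂ n x⟩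
    refine (hG _ hv).tendsto.comp (tendsto_nhdsWithin_iff.2 ⟨hx₁.prodMk_nhds hx₂, ?_⟩)
    exact Eventually.of_forall fun n => hmem n x
  have hcont : ∀ {G : ℝ × ℝ → ℝ}, ContinuousOn G (Ici 0) → ∀ n,
      AEStronglyMeasurable (fun x => G (φ₁ n x, φ₂ n x)) (volume.restrict Ω) := fun hG n =>
    (hG.comp_continuous ((h₁.isTestFunction n).continuous.prodMk
      (h₂.isTestFunction n).continuous) (hmem n)).aestronglyMeasurable
  refine IsTestLimit.of_gradient_eq hw h₁ h₂ (fun n => ?_) (fun n x => ?_)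
    (hlim fun q hq => (hF q hq).continuousAt.continuousWithinAt) (hcont ha) (hcont hb)
    (fun n x => haC _ (hmem n x)) (fun n x => hbC _ (hmem n x)) (hlim ha) (hlim hb)
  · refine IsTestFunction.of_eq_zero (h₁.isTestFunction n) (h₂.isTestFunction n) ?_ ?_
    · rw [contDiff_iff_contDiffAt]
      intro x
      exact (hF _ (hmem n x)).comp x ((h₁.isTestFunction n).contDiff.contDiffAt.prodMk
        (h₂.isTestFunction n).contDiff.contDiffAt)
    · intro x hx₁ hx₂
      rw [hx₁, hx₂]
      exact hF0
  · refine gradient_eq_of_hasFDerivAt (((hF' _ (hmem n x)).comp x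
      (((h₁.isTestFunction n).differentiable x).hasFDerivAt.prodMk
        ((h₂.isTestFunction n).differentiable x).hasFDerivAt)).congr_fderiv ?_)
    ext z
    simp

/-! ### The regularized test functions -/

/-- A bounded, concave truncation of `s ≥ 0`, shifted away from zero; it tends to `s` as
`ε → 0`. -/
noncomputable def shiftedTrunc (ε s : ℝ) : ℝ := ε + s / (1 + ε * s)

/-- The derivative of `shiftedTrunc ε`. -/
noncomputable def truncSlope (ε s : ℝ) : ℝ := ((1 + ε * s) ^ 2)⁻¹

/-- The regularized difference of the `p`-th powers. -/
noncomputable def powGap (p ε : ℝ) (q : ℝ × ℝ) : ℝ := shiftedTrunc ε q.1 ^ p - (q.2 + ε) ^ p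

/-- The smoothed positive part of `powGap`. The smoothing parameter `ε ^ (p + 1)` is small even
after division by the least value `ε ^ p` of `(q.2 + ε) ^ p`. -/
noncomputable def gapPos (p ε : ℝ) (q : ℝ × ℝ) : ℝ := softPos (ε ^ (p + 1)) (powGap p ε q)

/-- The slope of the smoothed positive part at `powGap`. -/
noncomputable def gapSlope (p ε : ℝ) (q : ℝ × ℝ) : ℝ := softPosDeriv (ε ^ (p + 1)) (powGap p ε q)

/-- The regularization of `(s ^ p - t ^ p)⁺ / s ^ (p - 1)`. -/
noncomputable def piconeFst (p ε : ℝ) (q : ℝ × ℝ) : ℝ :=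
  gapPos p ε q * shiftedTrunc ε q.1 ^ (1 - p)

/-- The regularization of `(s ^ p - t ^ p)⁺ / t ^ (p - 1)`. -/
noncomputable def piconeSnd (p ε : ℝ) (q : ℝ × ℝ) : ℝ := gapPos p ε q * (q.2 + ε) ^ (1 - p)

/-- The first partial derivative of `piconeFst`. -/
noncomputable def piconeFstDs (p ε : ℝ) (q : ℝ × ℝ) : ℝ :=
  gapSlope p ε q * p * truncSlope ε q.1 -
    (p - 1) * gapPos p ε q * truncSlope ε q.1 * shiftedTrunc ε q.1 ^ (-p)

/-- The second partial derivative of `piconeFst`. -/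
noncomputable def piconeFstDt (p ε : ℝ) (q : ℝ × ℝ) : ℝ :=
  -(gapSlope p ε q * p * ((q.2 + ε) / shiftedTrunc ε q.1) ^ (p - 1))

/-- The first partial derivative of `piconeSnd`. -/
noncomputable def piconeSndDs (p ε : ℝ) (q : ℝ × ℝ) : ℝ :=
  gapSlope p ε q * p * (shiftedTrunc ε q.1 / (q.2 + ε)) ^ (p - 1) * truncSlope ε q.1

/-- The second partial derivative of `piconeSnd`. -/
noncomputable def piconeSndDt (p ε : ℝ) (q : ℝ × ℝ) : ℝ :=
  -(gapSlope p ε q * p) - (p - 1) * gapPos p ε q * (q.2 + ε) ^ (-p)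

section Regularized

variable {p ε : ℝ} {q : ℝ × ℝ}

theorem le_shiftedTrunc (hε : 0 < ε) {s : ℝ} (hs : 0 ≤ s) : ε ≤ shiftedTrunc ε s :=
  le_add_of_nonneg_right (by positivity)

theorem shiftedTrunc_pos (hε : 0 < ε) {s : ℝ} (hs : 0 ≤ s) : 0 < shiftedTrunc ε s :=
  hε.trans_le (le_shiftedTrunc hε hs)

theorem shiftedTrunc_le_add (hε : 0 < ε) {s : ℝ} (hs : 0 ≤ s) : shiftedTrunc ε s ≤ ε + s := by
  have : s / (1 + ε * s) ≤ s := div_le_self hs (by nlinarith)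
  unfold shiftedTrunc
  linarith

theorem shiftedTrunc_le (hε : 0 < ε) {s : ℝ} (hs : 0 ≤ s) : shiftedTrunc ε s ≤ ε + 1 / ε := by
  refine add_le_add le_rfl ?_
  rw [div_le_div_iff₀ (by positivity) hε]
  linarith

theorem truncSlope_nonneg {s : ℝ} : 0 ≤ truncSlope ε s := by
  unfold truncSlope
  positivity

theorem truncSlope_le_one (hε : 0 < ε) {s : ℝ} (hs : 0 ≤ s) : truncSlope ε s ≤ 1 := by
  have := mul_nonneg hε.le hs
  exact inv_le_one_of_one_le₀ (one_le_pow₀ (by linarith))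

theorem hasDerivAt_shiftedTrunc (hε : 0 < ε) {s : ℝ} (hs : 0 ≤ s) :
    HasDerivAt (shiftedTrunc ε) (truncSlope ε s) s := by
  have h0 : 1 + ε * s ≠ 0 := by positivity
  have h := ((hasDerivAt_id' s).div (((hasDerivAt_id' s).const_mul ε).const_add 1) h0).const_add ε
  refine h.congr_deriv ?_
  unfold truncSlope
  field_simp
  ring

theorem gapPos_nonneg (hε : 0 < ε) : 0 ≤ gapPos p ε q := softPos_nonneg (by positivity)

theorem gapPos_le (hε : 0 < ε) (hq : 0 ≤ q) : gapPos p ε q ≤ shiftedTrunc ε q.1 ^ p := by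
  have h1 : 0 ≤ (q.2 + ε) ^ p := Real.rpow_nonneg (add_nonneg hq.2 hε.le) p
  have h2 : 0 ≤ shiftedTrunc ε q.1 ^ p := Real.rpow_nonneg (shiftedTrunc_pos hε hq.1).le p
  refine (softPos_le (by positivity)).trans (max_le ?_ h2)
  unfold powGap
  linarith

theorem gapSlope_nonneg (hε : 0 < ε) : 0 ≤ gapSlope p ε q := softPosDeriv_nonneg (by positivity)

theorem gapSlope_le_one : gapSlope p ε q ≤ 1 := softPosDeriv_le_one

theorem hasFDerivAt_shiftedTrunc_fst (hε : 0 < ε) (hq : 0 ≤ q) :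
    HasFDerivAt (fun q : ℝ × ℝ => shiftedTrunc ε q.1)
      (truncSlope ε q.1 • ContinuousLinearMap.fst ℝ ℝ ℝ) q :=
  (hasDerivAt_shiftedTrunc hε hq.1).comp_hasFDerivAt q hasFDerivAt_fst

theorem hasFDerivAt_snd_add : HasFDerivAt (fun q : ℝ × ℝ => q.2 + ε)
    (ContinuousLinearMap.snd ℝ ℝ ℝ) q :=
  hasFDerivAt_snd.add_const ε

theorem hasFDerivAt_gapPos (hε : 0 < ε) (hq : 0 ≤ q) :
    HasFDerivAt (gapPos p ε) (gapSlope p ε q • ((p * shiftedTrunc ε q.1 ^ (p - 1)) •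
      truncSlope ε q.1 • ContinuousLinearMap.fst ℝ ℝ ℝ -
        (p * (q.2 + ε) ^ (p - 1)) • ContinuousLinearMap.snd ℝ ℝ ℝ)) q := by
  have hA := shiftedTrunc_pos hε hq.1
  have hb : 0 < q.2 + ε := add_pos_of_nonneg_of_pos hq.2 hε
  exact (hasDerivAt_softPos (Real.rpow_pos_of_pos hε (p + 1)) _).comp_hasFDerivAt q
    (((hasFDerivAt_shiftedTrunc_fst hε hq).rpow_const (Or.inl hA.ne')).sub
      (hasFDerivAt_snd_add.rpow_const (Or.inl hb.ne')))

theorem hasFDerivAt_piconeFst (hε : 0 < ε) (hq : 0 ≤ q) :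
    HasFDerivAt (piconeFst p ε) (piconeFstDs p ε q • ContinuousLinearMap.fst ℝ ℝ ℝ +
      piconeFstDt p ε q • ContinuousLinearMap.snd ℝ ℝ ℝ) q := by
  have hA := shiftedTrunc_pos hε hq.1
  have hb : 0 < q.2 + ε := add_pos_of_nonneg_of_pos hq.2 hε
  refine ((hasFDerivAt_gapPos (p := p) hε hq).mul ((hasFDerivAt_shiftedTrunc_fst hε hq).rpow_const
    (p := 1 - p) (Or.inl hA.ne'))).congr_fderiv ?_
  have e1 : shiftedTrunc ε q.1 ^ (1 - p) * shiftedTrunc ε q.1 ^ (p - 1) = 1 := by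
    rw [← Real.rpow_add hA]; simp
  have e2 : ((q.2 + ε) / shiftedTrunc ε q.1) ^ (p - 1) =
      shiftedTrunc ε q.1 ^ (1 - p) * (q.2 + ε) ^ (p - 1) := by
    rw [Real.div_rpow hb.le hA.le, ← neg_sub p 1, Real.rpow_neg hA.le]; ring
  have e3 : (1 - p - 1 : ℝ) = -p := by ring
  ext
  · simp only [piconeFstDs, piconeFstDt, e2, e3, ContinuousLinearMap.coe_comp, Function.comp_apply,
      FunLike.coe_add, FunLike.coe_smul, FunLike.coe_sub, Pi.add_apply, Pi.smul_apply, Pi.sub_apply,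
      ContinuousLinearMap.inl_apply, ContinuousLinearMap.coe_fst', ContinuousLinearMap.coe_snd',
      smul_eq_mul]
    linear_combination (gapSlope p ε q * p * truncSlope ε q.1) * e1
  · simp [piconeFstDt, e2]
    ring

theorem hasFDerivAt_piconeSnd (hε : 0 < ε) (hq : 0 ≤ q) :
    HasFDerivAt (piconeSnd p ε) (piconeSndDs p ε q • ContinuousLinearMap.fst ℝ ℝ ℝ +
      piconeSndDt p ε q • ContinuousLinearMap.snd ℝ ℝ ℝ) q := by
  have hA := shiftedTrunc_pos hε hq.1
  have hb : 0 < q.2 + ε := add_pos_of_nonneg_of_pos hq.2 hε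
  refine ((hasFDerivAt_gapPos (p := p) hε hq).mul (hasFDerivAt_snd_add.rpow_const
    (p := 1 - p) (Or.inl hb.ne'))).congr_fderiv ?_
  have e1 : (q.2 + ε) ^ (1 - p) * (q.2 + ε) ^ (p - 1) = 1 := by
    rw [← Real.rpow_add hb]; simp
  have e2 : (shiftedTrunc ε q.1 / (q.2 + ε)) ^ (p - 1) =
      (q.2 + ε) ^ (1 - p) * shiftedTrunc ε q.1 ^ (p - 1) := by
    rw [Real.div_rpow hA.le hb.le, ← neg_sub p 1, Real.rpow_neg hb.le]; ring
  have e3 : (1 - p - 1 : ℝ) = -p := by ring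
  ext
  · simp [piconeSndDs, e2]
    ring
  · simp only [piconeSndDs, piconeSndDt, e2, e3, ContinuousLinearMap.coe_comp, Function.comp_apply,
      FunLike.coe_add, FunLike.coe_smul, FunLike.coe_sub, Pi.add_apply, Pi.smul_apply, Pi.sub_apply,
      ContinuousLinearMap.inr_apply, ContinuousLinearMap.coe_fst', ContinuousLinearMap.coe_snd',
      smul_eq_mul]
    linear_combination -(gapSlope p ε q * p) * e1

theorem contDiffAt_shiftedTrunc_rpow (hε : 0 < ε) (hq : 0 ≤ q) (r : ℝ) :
    ContDiffAt ℝ 1 (fun q : ℝ × ℝ => shiftedTrunc ε q.1 ^ r) q := by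
  have h0 : 1 + ε * q.1 ≠ 0 := by
    have := mul_nonneg hε.le hq.1
    positivity
  refine ContDiffAt.rpow_const_of_ne ?_ (shiftedTrunc_pos hε hq.1).ne'
  exact contDiffAt_const.add (contDiffAt_fst.div (by fun_prop) h0)

theorem contDiffAt_snd_add_rpow (hε : 0 < ε) (hq : 0 ≤ q) (r : ℝ) :
    ContDiffAt ℝ 1 (fun q : ℝ × ℝ => (q.2 + ε) ^ r) q :=
  ContDiffAt.rpow_const_of_ne (by fun_prop) (add_pos_of_nonneg_of_pos hq.2 hε).ne'

theorem contDiffAt_gapPos (hε : 0 < ε) (hq : 0 ≤ q) : ContDiffAt ℝ 1 (gapPos p ε) q :=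
  (contDiff_softPos (Real.rpow_pos_of_pos hε (p + 1))).contDiffAt.comp q
    ((contDiffAt_shiftedTrunc_rpow hε hq p).sub (contDiffAt_snd_add_rpow hε hq p))

theorem contDiffAt_piconeFst (hε : 0 < ε) (hq : 0 ≤ q) : ContDiffAt ℝ 1 (piconeFst p ε) q :=
  (contDiffAt_gapPos hε hq).mul (contDiffAt_shiftedTrunc_rpow hε hq _)

theorem contDiffAt_piconeSnd (hε : 0 < ε) (hq : 0 ≤ q) : ContDiffAt ℝ 1 (piconeSnd p ε) q :=
  (contDiffAt_gapPos hε hq).mul (contDiffAt_snd_add_rpow hε hq _)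

theorem continuousAt_gapSlope (hε : 0 < ε) (hq : 0 ≤ q) : ContinuousAt (gapSlope p ε) q :=
  (continuous_softPosDeriv (Real.rpow_pos_of_pos hε (p + 1))).continuousAt.comp
    ((contDiffAt_shiftedTrunc_rpow hε hq p).sub (contDiffAt_snd_add_rpow hε hq p)).continuousAt

theorem continuousAt_truncSlope (hε : 0 < ε) (hq : 0 ≤ q) :
    ContinuousAt (fun q : ℝ × ℝ => truncSlope ε q.1) q := by
  have h0 : (1 + ε * q.1) ^ 2 ≠ 0 := by
    have := mul_nonneg hε.le hq.1
    positivity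
  exact ContinuousAt.inv₀ (by fun_prop) h0

theorem continuousAt_shiftedTrunc (hε : 0 < ε) (hq : 0 ≤ q) :
    ContinuousAt (fun q : ℝ × ℝ => shiftedTrunc ε q.1) q :=
  (hasFDerivAt_shiftedTrunc_fst hε hq).continuousAt

theorem continuousAt_piconeFstDs (hε : 0 < ε) (hq : 0 ≤ q) : ContinuousAt (piconeFstDs p ε) q :=
  (((continuousAt_gapSlope hε hq).mul continuousAt_const).mul (continuousAt_truncSlope hε hq)).sub
    (((continuousAt_const.mul (contDiffAt_gapPos hε hq).continuousAt).mul
      (continuousAt_truncSlope hε hq)).mul (contDiffAt_shiftedTrunc_rpow hε hq _).continuousAt)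

theorem continuousAt_piconeFstDt (hp : 1 < p) (hε : 0 < ε) (hq : 0 ≤ q) :
    ContinuousAt (piconeFstDt p ε) q :=
  (((continuousAt_gapSlope hε hq).mul continuousAt_const).mul
    ((ContinuousAt.div (by fun_prop) (continuousAt_shiftedTrunc hε hq)
      (shiftedTrunc_pos hε hq.1).ne').rpow_const (Or.inr (by linarith)))).neg

theorem continuousAt_piconeSndDs (hp : 1 < p) (hε : 0 < ε) (hq : 0 ≤ q) :
    ContinuousAt (piconeSndDs p ε) q :=
  (((continuousAt_gapSlope hε hq).mul continuousAt_const).mul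
    (((continuousAt_shiftedTrunc hε hq).div (by fun_prop)
      (add_pos_of_nonneg_of_pos hq.2 hε).ne').rpow_const (Or.inr (by linarith)))).mul
    (continuousAt_truncSlope hε hq)

theorem continuousAt_piconeSndDt (hε : 0 < ε) (hq : 0 ≤ q) : ContinuousAt (piconeSndDt p ε) q :=
  ((continuousAt_gapSlope hε hq).mul continuousAt_const).neg.sub
    ((continuousAt_const.mul (contDiffAt_gapPos hε hq).continuousAt).mul
      (contDiffAt_snd_add_rpow hε hq _).continuousAt)

theorem piconeFst_zero : piconeFst p ε 0 = 0 := by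
  simp [piconeFst, gapPos, powGap, shiftedTrunc, softPos]

theorem piconeSnd_zero : piconeSnd p ε 0 = 0 := by
  simp [piconeSnd, gapPos, powGap, shiftedTrunc, softPos]

theorem gapSlope_eq_zero (hε : 0 < ε) (h : powGap p ε q ≤ 0) : gapSlope p ε q = 0 :=
  softPosDeriv_of_nonpos (by positivity) h

theorem abs_piconeFstDs_le (hp : 1 < p) (hε : 0 < ε) (hq : 0 ≤ q) :
    |piconeFstDs p ε q| ≤ 2 * p := by
  have hA := shiftedTrunc_pos hε hq.1
  have h1 : gapPos p ε q * shiftedTrunc ε q.1 ^ (-p) ≤ 1 := by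
    refine (mul_le_mul_of_nonneg_right (gapPos_le hε hq) (by positivity)).trans_eq ?_
    rw [← Real.rpow_add hA]; simp
  have h0 : 0 ≤ gapPos p ε q * shiftedTrunc ε q.1 ^ (-p) :=
    mul_nonneg (gapPos_nonneg hε) (by positivity)
  have hd := gapSlope_nonneg (p := p) (q := q) hε
  have hd1 := gapSlope_le_one (p := p) (q := q) (ε := ε)
  have hτ := truncSlope_nonneg (ε := ε) (s := q.1)
  have hτ1 := truncSlope_le_one hε hq.1
  have e : piconeFstDs p ε q = truncSlope ε q.1 * (p * gapSlope p ε q -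
      (p - 1) * (gapPos p ε q * shiftedTrunc ε q.1 ^ (-p))) := by
    unfold piconeFstDs; ring
  rw [e, abs_mul, abs_of_nonneg hτ]
  refine (mul_le_of_le_one_left (abs_nonneg _) hτ1).trans (abs_le.2 ⟨?_, ?_⟩) <;> nlinarith

theorem abs_piconeFstDt_le (hp : 1 < p) (hε : 0 < ε) (hq : 0 ≤ q) :
    |piconeFstDt p ε q| ≤ p := by
  have hA := shiftedTrunc_pos hε hq.1
  have hb : 0 < q.2 + ε := add_pos_of_nonneg_of_pos hq.2 hε
  have hd := gapSlope_nonneg (p := p) (q := q) hε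
  have hd1 := gapSlope_le_one (p := p) (q := q) (ε := ε)
  have hp0 : 0 ≤ p := by linarith
  unfold piconeFstDt
  rw [abs_neg, abs_of_nonneg (by positivity)]
  by_cases hw : powGap p ε q ≤ 0
  · simp [gapSlope_eq_zero hε hw, hp0]
  · have hbA : q.2 + ε ≤ shiftedTrunc ε q.1 := by
      by_contra! hlt
      exact hw (sub_nonpos.2 (Real.rpow_le_rpow hA.le hlt.le hp0))
    have : ((q.2 + ε) / shiftedTrunc ε q.1) ^ (p - 1) ≤ 1 :=
      Real.rpow_le_one (by positivity) ((div_le_one hA).2 hbA) (by linarith)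
    calc _ ≤ 1 * p * 1 := by gcongr
      _ = p := by ring

theorem one_le_truncRatio (hε : 0 < ε) : 1 ≤ (ε + 1 / ε) / ε := by
  rw [le_div_iff₀ hε]
  have : 0 < 1 / ε := by positivity
  linarith

theorem shiftedTrunc_div_le (hε : 0 < ε) (hq : 0 ≤ q) :
    shiftedTrunc ε q.1 / (q.2 + ε) ≤ (ε + 1 / ε) / ε :=
  div_le_div₀ (by positivity) (shiftedTrunc_le hε hq.1) hε (le_add_of_nonneg_left hq.2)

theorem abs_piconeSndDs_le (hp : 1 < p) (hε : 0 < ε) (hq : 0 ≤ q) :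
    |piconeSndDs p ε q| ≤ 2 * p * ((ε + 1 / ε) / ε) ^ p := by
  have hA := shiftedTrunc_pos hε hq.1
  have hb : 0 < q.2 + ε := add_pos_of_nonneg_of_pos hq.2 hε
  have hd := gapSlope_nonneg (p := p) (q := q) hε
  have hd1 := gapSlope_le_one (p := p) (q := q) (ε := ε)
  have hτ := truncSlope_nonneg (ε := ε) (s := q.1)
  have hτ1 := truncSlope_le_one hε hq.1
  have hp0 : 0 ≤ p := by linarith
  have h1 : (shiftedTrunc ε q.1 / (q.2 + ε)) ^ (p - 1) ≤ ((ε + 1 / ε) / ε) ^ p :=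
    (Real.rpow_le_rpow (by positivity) (shiftedTrunc_div_le hε hq) (by linarith)).trans
      (Real.rpow_le_rpow_of_exponent_le (one_le_truncRatio hε) (by linarith))
  have hR : 0 ≤ p * ((ε + 1 / ε) / ε) ^ p := by positivity
  unfold piconeSndDs
  rw [abs_of_nonneg (by positivity)]
  calc _ ≤ 1 * p * ((ε + 1 / ε) / ε) ^ p * 1 := by gcongr
    _ ≤ _ := by linarith

theorem abs_piconeSndDt_le (hp : 1 < p) (hε : 0 < ε) (hq : 0 ≤ q) :
    |piconeSndDt p ε q| ≤ 2 * p * ((ε + 1 / ε) / ε) ^ p := by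
  have hA := shiftedTrunc_pos hε hq.1
  have hb : 0 < q.2 + ε := add_pos_of_nonneg_of_pos hq.2 hε
  have hd := gapSlope_nonneg (p := p) (q := q) hε
  have hd1 := gapSlope_le_one (p := p) (q := q) (ε := ε)
  have hh := gapPos_nonneg (p := p) (q := q) hε
  have h1 : gapPos p ε q * (q.2 + ε) ^ (-p) ≤ ((ε + 1 / ε) / ε) ^ p := by
    refine (mul_le_mul_of_nonneg_right (gapPos_le hε hq) (by positivity)).trans ?_
    rw [Real.rpow_neg hb.le, ← div_eq_mul_inv, ← Real.div_rpow hA.le hb.le]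
    exact Real.rpow_le_rpow (by positivity) (shiftedTrunc_div_le hε hq) (by linarith)
  have h0 : 0 ≤ gapPos p ε q * (q.2 + ε) ^ (-p) := by positivity
  have hR : 1 ≤ ((ε + 1 / ε) / ε) ^ p := Real.one_le_rpow (one_le_truncRatio hε) (by linarith)
  have e : piconeSndDt p ε q =
      -(p * gapSlope p ε q + (p - 1) * (gapPos p ε q * (q.2 + ε) ^ (-p))) := by
    unfold piconeSndDt; ring
  generalize gapPos p ε q * (q.2 + ε) ^ (-p) = y at *
  generalize ((ε + 1 / ε) / ε) ^ p = R at *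
  have i1 : p * gapSlope p ε q ≤ p * 1 := mul_le_mul_of_nonneg_left hd1 (by linarith)
  have i2 : (p - 1) * y ≤ (p - 1) * R := mul_le_mul_of_nonneg_left h1 (by linarith)
  have i3 : 0 ≤ p * gapSlope p ε q := mul_nonneg (by linarith) hd
  have i4 : 0 ≤ (p - 1) * y := mul_nonneg (by linarith) h0
  rw [e, abs_neg, abs_of_nonneg (by linarith)]
  nlinarith

/-- The bound is linear in `q.1` without an additive constant, so that it can be integrated against
the source term. -/
theorem piconeFst_le (hp : 1 < p) (hε : 0 < ε) (hq : 0 ≤ q) : piconeFst p ε q ≤ p * q.1 := by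
  have hA := shiftedTrunc_pos hε hq.1
  have hb : 0 < q.2 + ε := add_pos_of_nonneg_of_pos hq.2 hε
  have hs : 0 ≤ q.1 := hq.1
  have hAs := shiftedTrunc_le_add hε hq.1
  refine (mul_le_mul_of_nonneg_right (softPos_le (by positivity)) (by positivity)).trans ?_
  rcases le_total (powGap p ε q) 0 with hw | hw
  · rw [max_eq_right hw, zero_mul]
    nlinarith
  rw [max_eq_left hw]
  unfold powGap
  generalize shiftedTrunc ε q.1 = A at *
  -- Bernoulli's inequality for the ratio of the two bases
  have hB := one_add_mul_self_le_rpow_one_add (s := (q.2 + ε) / A - 1)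
    (by linarith [show 0 ≤ (q.2 + ε) / A by positivity]) hp.le
  rw [add_sub_cancel, Real.div_rpow hb.le hA.le] at hB
  have h1 : (A ^ p - (q.2 + ε) ^ p) * A ^ (1 - p) = A * (1 - (q.2 + ε) ^ p / A ^ p) := by
    rw [Real.rpow_sub hA, Real.rpow_one]
    field_simp
  have h2 : A * (p * ((q.2 + ε) / A - 1)) = p * (q.2 + ε - A) := by field_simp
  rw [h1]
  have ht : 0 ≤ q.2 := hq.2
  nlinarith

theorem piconeFst_nonneg (hε : 0 < ε) (hq : 0 ≤ q) : 0 ≤ piconeFst p ε q :=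
  mul_nonneg (gapPos_nonneg hε) (Real.rpow_nonneg (shiftedTrunc_pos hε hq.1).le _)

theorem piconeSnd_nonneg (hε : 0 < ε) (hq : 0 ≤ q) : 0 ≤ piconeSnd p ε q :=
  mul_nonneg (gapPos_nonneg hε) (Real.rpow_nonneg (add_nonneg hq.2 hε.le) _)

section Limit

variable {ε : ℕ → ℝ} {s t : ℝ}

theorem tendsto_shiftedTrunc (hε : Tendsto ε atTop (𝓝 0)) :
    Tendsto (fun n => shiftedTrunc (ε n) s) atTop (𝓝 s) := by
  have h := hε.add ((tendsto_const_nhds (x := s)).div ((hε.mul_const s).const_add 1) (by simp))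
  simpa [shiftedTrunc] using h

theorem tendsto_truncSlope (hε : Tendsto ε atTop (𝓝 0)) :
    Tendsto (fun n => truncSlope (ε n) s) atTop (𝓝 1) := by
  have h := (((hε.mul_const s).const_add 1).pow 2).inv₀ (by simp)
  simpa [truncSlope] using h

theorem tendsto_gapPos (hp : 1 < p) (hε : Tendsto ε atTop (𝓝 0)) (hε0 : ∀ n, 0 < ε n) (hs : 0 < s)
    (ht : 0 < t) : Tendsto (fun n => gapPos p (ε n) (s, t)) atTop (𝓝 (max (s ^ p - t ^ p) 0)) := by
  have h1 : Tendsto (fun n => powGap p (ε n) (s, t)) atTop (𝓝 (s ^ p - t ^ p)) := by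
    have h2 : Tendsto (fun n => t + ε n) atTop (𝓝 t) := by simpa using hε.const_add t
    exact ((tendsto_shiftedTrunc hε).rpow_const (Or.inl hs.ne')).sub
      (h2.rpow_const (Or.inl ht.ne'))
  have h3 : Tendsto (fun n => ε n ^ (p + 1)) atTop (𝓝 0) := by
    have := hε.rpow_const (p := p + 1) (Or.inr (by linarith))
    rwa [Real.zero_rpow (by linarith)] at this
  have h4 := h1.max (tendsto_const_nhds (x := (0 : ℝ)))
  refine tendsto_of_tendsto_of_tendsto_of_le_of_le (by simpa using h4.sub h3) h4
    (fun n => sub_le_softPos (Real.rpow_pos_of_pos (hε0 n) _))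
    (fun n => softPos_le (Real.rpow_pos_of_pos (hε0 n) _))

theorem tendsto_piconeFst (hp : 1 < p) (hε : Tendsto ε atTop (𝓝 0)) (hε0 : ∀ n, 0 < ε n)
    (hs : 0 < s) (ht : 0 < t) : Tendsto (fun n => piconeFst p (ε n) (s, t)) atTop
      (𝓝 (max (s ^ p - t ^ p) 0 * s ^ (1 - p))) :=
  (tendsto_gapPos hp hε hε0 hs ht).mul
    ((tendsto_shiftedTrunc hε).rpow_const (Or.inl hs.ne'))

theorem tendsto_piconeSnd (hp : 1 < p) (hε : Tendsto ε atTop (𝓝 0)) (hε0 : ∀ n, 0 < ε n)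
    (hs : 0 < s) (ht : 0 < t) : Tendsto (fun n => piconeSnd p (ε n) (s, t)) atTop
      (𝓝 (max (s ^ p - t ^ p) 0 * t ^ (1 - p))) := by
  have h2 : Tendsto (fun n => t + ε n) atTop (𝓝 t) := by simpa using hε.const_add t
  exact (tendsto_gapPos hp hε hε0 hs ht).mul (h2.rpow_const (Or.inl ht.ne'))

end Limit

end Regularized

/-! ### Comparison -/

section

variable {N : ℕ} {p : ℝ} {H : EuclideanSpace ℝ (Fin N) → ℝ} {Ω : Set (EuclideanSpace ℝ (Fin N))}

/-- Picone's inequality for the two fluxes, tested with the regularized test functions. -/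
theorem IsEllipticFinsler.picone (hH : IsEllipticFinsler H) (hp : 1 < p) {ε : ℝ} (hε : 0 < ε)
    {q : ℝ × ℝ} (hq : 0 ≤ q) (ξ₁ ξ₂ : EuclideanSpace ℝ (Fin N)) :
    inner ℝ (finslerFlux p H ξ₂) (piconeSndDs p ε q • ξ₁ + piconeSndDt p ε q • ξ₂) ≤
      inner ℝ (finslerFlux p H ξ₁) (piconeFstDs p ε q • ξ₁ + piconeFstDt p ε q • ξ₂) +
        (p * (1 - truncSlope ε q.1) * (finslerGauge H ξ₁ ^ (p - 1) * finslerGauge H ξ₂) +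
          (p - 1) * ε * finslerGauge H ξ₂ ^ p) := by
  have hb : 0 < q.2 + ε := add_pos_of_nonneg_of_pos hq.2 hε
  have hδ : 0 < ε ^ (p + 1) := Real.rpow_pos_of_pos hε _
  have hmem := mul_softPosDeriv_sub_softPos_mem_Icc (w := powGap p ε q) hδ
  have key := picone_regularized (h := gapPos p ε q) (d := gapSlope p ε q) hp
    (shiftedTrunc_pos hε hq.1) hb truncSlope_nonneg
    (truncSlope_le_one hε hq.1) (gapSlope_nonneg hε) gapSlope_le_one (gapSlope_eq_zero hε)
    hmem.1 hmem.2 (sub_sub_cancel _ _).symm (hH.finslerGauge_nonneg ξ₁) (hH.finslerGauge_nonneg ξ₂)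
    (hH.inner_finslerFlux_le hp ξ₁ ξ₂) (hH.inner_finslerFlux_le hp ξ₂ ξ₁)
  rw [← hH.inner_finslerFlux_self hp, ← hH.inner_finslerFlux_self hp] at key
  have hbε : ε ^ (p + 1) * (q.2 + ε) ^ (-p) ≤ ε := by
    have h1 : (q.2 + ε) ^ (-p) ≤ ε ^ (-p) :=
      Real.rpow_le_rpow_of_nonpos hε (le_add_of_nonneg_left hq.2) (by linarith)
    calc _ ≤ ε ^ (p + 1) * ε ^ (-p) := by gcongr
      _ = ε := by rw [← Real.rpow_add hε]; simp
  have hK : 0 ≤ (p - 1) * inner ℝ (finslerFlux p H ξ₂) ξ₂ := by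
    rw [hH.inner_finslerFlux_self hp]
    exact mul_nonneg (by linarith) (Real.rpow_nonneg (hH.finslerGauge_nonneg ξ₂) _)
  have h2 := mul_le_mul_of_nonneg_left hbε hK
  rw [← hH.inner_finslerFlux_self hp ξ₂]
  simp only [inner_add_right, real_inner_smul_right]
  simp only [piconeFstDs, piconeFstDt, piconeSndDs, piconeSndDt] at *
  linarith

/-- Comparison of two positive functions of `W₀^{1,p}(Ω)` under a pointwise strict inequality of
the quotients of source term and `(p - 1)`-st power, where the first function exceeds the second. -/
theorem ae_le_of_forall_div_lt (hp : 1 < p) (hH : IsEllipticFinsler H)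
    {v₁ v₂ g₁ g₂ : EuclideanSpace ℝ (Fin N) → ℝ}
    {V₁ V₂ : EuclideanSpace ℝ (Fin N) → EuclideanSpace ℝ (Fin N)}
    (hv₁ : MemSobolevZero p Ω v₁ V₁) (hv₂ : MemSobolevZero p Ω v₂ V₂)
    (hpos₁ : ∀ᵐ x ∂(volume.restrict Ω), 0 < v₁ x) (hpos₂ : ∀ᵐ x ∂(volume.restrict Ω), 0 < v₂ x)
    (hY₁ : IsNonnegDivergence Ω g₁ (fun x => finslerFlux p H (V₁ x)))
    (hY₂ : IsNonnegDivergence Ω g₂ (fun x => finslerFlux p H (V₂ x)))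
    (hlt : ∀ᵐ x ∂(volume.restrict Ω), v₂ x < v₁ x →
      g₁ x / v₁ x ^ (p - 1) < g₂ x / v₂ x ^ (p - 1)) :
    ∀ᵐ x ∂(volume.restrict Ω), v₁ x ≤ v₂ x := by
  have hp0 : 0 < p := by linarith
  have hp1 : 0 < p - 1 := by linarith
  obtain ⟨C, hC0, hC⟩ := hH.exists_norm_finslerFlux_le hp
  obtain ⟨D, hD0, hD⟩ := hH.exists_finslerGauge_le
  -- a common weight which dominates both fluxes and the powers of `H` at the gradients
  set w : EuclideanSpace ℝ (Fin N) → ℝ := fun x =>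
    (C + D ^ (p - 1)) * (‖V₁ x‖ ^ (p - 1) + ‖V₂ x‖ ^ (p - 1))
  have hwp : MemLp w (ENNReal.ofReal p / ENNReal.ofReal (p - 1)) (volume.restrict Ω) := by
    have h1 := hv₁.memLp_grad.norm_rpow_div (ENNReal.ofReal (p - 1))
    have h2 := hv₂.memLp_grad.norm_rpow_div (ENNReal.ofReal (p - 1))
    rw [ENNReal.toReal_ofReal hp1.le] at h1 h2
    exact (h1.add h2).const_mul _
  have hwm := hwp.aestronglyMeasurable
  have hw0 : ∀ x, 0 ≤ w x := fun x => by positivity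
  have hDp : 0 ≤ D ^ (p - 1) := by positivity
  have hn₁ : ∀ x, 0 ≤ ‖V₁ x‖ ^ (p - 1) := fun x => by positivity
  have hn₂ : ∀ x, 0 ≤ ‖V₂ x‖ ^ (p - 1) := fun x => by positivity
  have hw₁ : ∀ x, ‖finslerFlux p H (V₁ x)‖ ≤ w x := fun x => (hC _).trans
    (mul_le_mul (by linarith) (by linarith [hn₂ x]) (hn₁ x) (by positivity))
  have hw₂ : ∀ x, ‖finslerFlux p H (V₂ x)‖ ≤ w x := fun x => (hC _).trans
    (mul_le_mul (by linarith) (by linarith [hn₁ x]) (hn₂ x) (by positivity))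
  have hK : ∀ ξ, finslerGauge H ξ ^ (p - 1) ≤ D ^ (p - 1) * ‖ξ‖ ^ (p - 1) := fun ξ => by
    rw [← Real.mul_rpow hD0 (norm_nonneg _)]
    exact Real.rpow_le_rpow (hH.finslerGauge_nonneg ξ) (hD ξ) hp1.le
  have hK₁ : ∀ x, finslerGauge H (V₁ x) ^ (p - 1) ≤ w x := fun x => (hK _).trans
    (mul_le_mul (by linarith) (by linarith [hn₂ x]) (hn₁ x) (by positivity))
  obtain ⟨φ₁, hφ₁, h₁⟩ := hv₁.exists_isTestLimit hp hpos₁ hwp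
  obtain ⟨φ₂, hφ₂, h₂⟩ := hv₂.exists_isTestLimit hp hpos₂ hwp
  have hV₁ := h₁.aestronglyMeasurable
  have hV₂ := h₂.aestronglyMeasurable
  have hY₁m := hY₁.aestronglyMeasurable
  have hY₂m := hY₂.aestronglyMeasurable
  have hgv := (hY₁.integral_eq_of_isTestLimit hw₁ h₁).1
  -- integrability of the two error terms
  have hM : IntegrableOn (fun x => finslerGauge H (V₁ x) ^ (p - 1) * finslerGauge H (V₂ x)) Ω := by
    have hm : AEStronglyMeasurable
        (fun x => finslerGauge H (V₁ x) ^ (p - 1) * finslerGauge H (V₂ x))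
        (volume.restrict Ω) :=
      (((hH.measurable_finslerGauge.comp_aemeasurable hV₁.aemeasurable).pow_const _).mul
        (hH.measurable_finslerGauge.comp_aemeasurable hV₂.aemeasurable)).aestronglyMeasurable
    have h3 : IntegrableOn (fun x => w x * ‖V₂ x‖) Ω := by
      refine ⟨hwm.mul hV₂.norm, lt_of_eq_of_lt (lintegral_congr fun x => ?_)
        h₂.lintegral_ne_top.lt_top⟩
      rw [enorm_mul, enorm_norm]
    refine Integrable.mono' (h3.const_mul D) hm (ae_of_all _ fun x => ?_)
    have hg₂ := hH.finslerGauge_nonneg (V₂ x)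
    rw [Real.norm_of_nonneg
      (mul_nonneg (Real.rpow_nonneg (hH.finslerGauge_nonneg _) _) hg₂)]
    calc _ ≤ w x * (D * ‖V₂ x‖) := mul_le_mul (hK₁ x) (hD _) hg₂ (hw0 x)
      _ = _ := by ring
  have hP : IntegrableOn (fun x => finslerGauge H (V₂ x) ^ p) Ω := by
    simp only [← hH.inner_finslerFlux_self hp]
    exact h₂.integrableOn_inner hY₂m hw₂
  set ε : ℕ → ℝ := fun n => 1 / ((n : ℝ) + 1) with hεdef
  have hε : Tendsto ε atTop (𝓝 0) := tendsto_one_div_succ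
  have hε0 : ∀ n, 0 < ε n := fun n => Nat.one_div_pos_of_nat
  have hε1 : ∀ n, ε n ≤ 1 := fun n => by
    rw [hεdef]
    exact div_le_one_of_le₀ (by linarith [(n.cast_nonneg : (0 : ℝ) ≤ n)]) (by positivity)
  have hFst : ∀ n, IsTestLimit Ω w (fun k x => piconeFst p (ε n) (φ₁ k x, φ₂ k x))
      (fun x => piconeFst p (ε n) (v₁ x, v₂ x))
      (fun x => piconeFstDs p (ε n) (v₁ x, v₂ x) • V₁ x +
        piconeFstDt p (ε n) (v₁ x, v₂ x) • V₂ x) := fun n =>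
    h₁.comp hwm h₂ hφ₁ hφ₂ piconeFst_zero (fun q hq => contDiffAt_piconeFst (hε0 n) hq)
      (fun q hq => hasFDerivAt_piconeFst (hε0 n) hq)
      (fun q hq => (continuousAt_piconeFstDs (hε0 n) hq).continuousWithinAt)
      (fun q hq => (continuousAt_piconeFstDt hp (hε0 n) hq).continuousWithinAt)
      (fun q hq => abs_piconeFstDs_le hp (hε0 n) hq)
      (fun q hq => (abs_piconeFstDt_le hp (hε0 n) hq).trans (by linarith))
  have hSnd : ∀ n, IsTestLimit Ω w (fun k x => piconeSnd p (ε n) (φ₁ k x, φ₂ k x))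
      (fun x => piconeSnd p (ε n) (v₁ x, v₂ x))
      (fun x => piconeSndDs p (ε n) (v₁ x, v₂ x) • V₁ x +
        piconeSndDt p (ε n) (v₁ x, v₂ x) • V₂ x) := fun n =>
    h₁.comp hwm h₂ hφ₁ hφ₂ piconeSnd_zero (fun q hq => contDiffAt_piconeSnd (hε0 n) hq)
      (fun q hq => hasFDerivAt_piconeSnd (hε0 n) hq)
      (fun q hq => (continuousAt_piconeSndDs hp (hε0 n) hq).continuousWithinAt)
      (fun q hq => (continuousAt_piconeSndDt (hε0 n) hq).continuousWithinAt)
      (fun q hq => abs_piconeSndDs_le hp (hε0 n) hq)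
      (fun q hq => abs_piconeSndDt_le hp (hε0 n) hq)
  set E : ℕ → EuclideanSpace ℝ (Fin N) → ℝ := fun n x =>
    p * (1 - truncSlope (ε n) (v₁ x)) *
      (finslerGauge H (V₁ x) ^ (p - 1) * finslerGauge H (V₂ x)) +
      (p - 1) * ε n * finslerGauge H (V₂ x) ^ p
  have hv₁m := hv₁.memLp.aestronglyMeasurable
  have hEm : ∀ n, AEStronglyMeasurable (E n) (volume.restrict Ω) := by
    intro n
    have hτ : AEStronglyMeasurable (fun x => truncSlope (ε n) (v₁ x)) (volume.restrict Ω) := by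
      have : Measurable (truncSlope (ε n)) := by unfold truncSlope; fun_prop
      exact (this.comp_aemeasurable hv₁m.aemeasurable).aestronglyMeasurable
    exact (((aestronglyMeasurable_const.sub hτ).const_mul p).mul hM.aestronglyMeasurable).add
      (hP.aestronglyMeasurable.const_mul _)
  have hEb : ∀ n, ∀ᵐ x ∂(volume.restrict Ω), ‖E n x‖ ≤
      p * (finslerGauge H (V₁ x) ^ (p - 1) * finslerGauge H (V₂ x)) +
        (p - 1) * finslerGauge H (V₂ x) ^ p := by
    intro n
    filter_upwards [hpos₁] with x hx
    have hg₁ := hH.finslerGauge_nonneg (V₁ x)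
    have hg₂ := hH.finslerGauge_nonneg (V₂ x)
    have hτ := truncSlope_nonneg (ε := ε n) (s := v₁ x)
    have hτ1 := truncSlope_le_one (hε0 n) hx.le
    have hτ2 : 0 ≤ 1 - truncSlope (ε n) (v₁ x) := by linarith
    have hεn := (hε0 n).le
    rw [Real.norm_of_nonneg (by positivity)]
    refine add_le_add ?_ ?_
    · refine mul_le_mul_of_nonneg_right ?_ (by positivity)
      exact mul_le_of_le_one_right hp0.le (by linarith)
    · refine mul_le_mul_of_nonneg_right ?_ (by positivity)
      exact mul_le_of_le_one_right hp1.le (hε1 n)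
  have hbound := (hM.const_mul p).add (hP.const_mul (p - 1))
  have hEi : ∀ n, IntegrableOn (E n) Ω := fun n => hbound.mono' (hEm n) (hEb n)
  have hElim : Tendsto (fun n => ∫ x in Ω, E n x) atTop (𝓝 0) := by
    have := tendsto_integral_of_dominated_convergence (f := fun _ => (0 : ℝ)) _ hEm hbound hEb
      (ae_of_all _ fun x => ?_)
    · simpa using this
    · have := ((((tendsto_truncSlope (s := v₁ x) hε).const_sub 1).const_mul p).mul_const
        (finslerGauge H (V₁ x) ^ (p - 1) * finslerGauge H (V₂ x))).add
        ((hε.const_mul (p - 1)).mul_const (finslerGauge H (V₂ x) ^ p))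
      simpa using this
  have hid₁ := fun n => hY₁.integral_eq_of_isTestLimit hw₁ (hFst n)
  have hid₂ := fun n => hY₂.integral_eq_of_isTestLimit hw₂ (hSnd n)
  have hineq : ∀ n, ∫ x in Ω, g₂ x * piconeSnd p (ε n) (v₁ x, v₂ x) ≤
      (∫ x in Ω, g₁ x * piconeFst p (ε n) (v₁ x, v₂ x)) + ∫ x in Ω, E n x := by
    intro n
    rw [← (hid₁ n).2, ← (hid₂ n).2,
      ← integral_add ((hFst n).integrableOn_inner hY₁m hw₁) (hEi n)]
    refine integral_mono_ae ((hSnd n).integrableOn_inner hY₂m hw₂)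
      (((hFst n).integrableOn_inner hY₁m hw₁).add (hEi n)) ?_
    filter_upwards [hpos₁, hpos₂] with x hx₁ hx₂
    exact hH.picone hp (hε0 n) (q := (v₁ x, v₂ x)) ⟨hx₁.le, hx₂.le⟩ (V₁ x) (V₂ x)
  -- the first source term converges by domination
  set ψ₁ : EuclideanSpace ℝ (Fin N) → ℝ := fun x =>
    max (v₁ x ^ p - v₂ x ^ p) 0 * v₁ x ^ (1 - p) with hψ₁
  set ψ₂ : EuclideanSpace ℝ (Fin N) → ℝ := fun x =>
    max (v₁ x ^ p - v₂ x ^ p) 0 * v₂ x ^ (1 - p) with hψ₂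
  have hlim₁ : ∀ᵐ x ∂(volume.restrict Ω),
      Tendsto (fun n => g₁ x * piconeFst p (ε n) (v₁ x, v₂ x)) atTop (𝓝 (g₁ x * ψ₁ x)) := by
    filter_upwards [hpos₁, hpos₂] with x hx₁ hx₂
    exact (tendsto_piconeFst hp hε hε0 hx₁ hx₂).const_mul _
  have hlim₂ : ∀ᵐ x ∂(volume.restrict Ω),
      Tendsto (fun n => g₂ x * piconeSnd p (ε n) (v₁ x, v₂ x)) atTop (𝓝 (g₂ x * ψ₂ x)) := by
    filter_upwards [hpos₁, hpos₂] with x hx₁ hx₂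
    exact (tendsto_piconeSnd hp hε hε0 hx₁ hx₂).const_mul _
  have hdom : ∀ n, ∀ᵐ x ∂(volume.restrict Ω),
      ‖g₁ x * piconeFst p (ε n) (v₁ x, v₂ x)‖ ≤ p * (g₁ x * v₁ x) := by
    intro n
    filter_upwards [hpos₁, hpos₂, hY₁.nonneg] with x hx₁ hx₂ hg
    have hq : (0 : ℝ × ℝ) ≤ (v₁ x, v₂ x) := ⟨hx₁.le, hx₂.le⟩
    rw [Real.norm_of_nonneg (mul_nonneg hg (piconeFst_nonneg (hε0 n) hq))]
    refine (mul_le_mul_of_nonneg_left (piconeFst_le hp (hε0 n) hq) hg).trans_eq ?_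
    ring
  have hconv := tendsto_integral_of_dominated_convergence _
    (fun n => (hid₁ n).1.aestronglyMeasurable) (hgv.const_mul p) hdom hlim₁
  have hi₁ : IntegrableOn (fun x => g₁ x * ψ₁ x) Ω := by
    refine (hgv.const_mul p).mono'
      (aestronglyMeasurable_of_tendsto_ae atTop (fun n => (hid₁ n).1.aestronglyMeasurable) hlim₁) ?_
    filter_upwards [ae_all_iff.2 hdom, hlim₁] with x hx hx'
    exact le_of_tendsto' hx'.norm hx
  have hψ₁0 : 0 ≤ᵐ[volume.restrict Ω] fun x => g₁ x * ψ₁ x := by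
    filter_upwards [hpos₁, hY₁.nonneg] with x hx₁ hg
    exact mul_nonneg hg (mul_nonneg (le_max_right _ _) (Real.rpow_nonneg hx₁.le _))
  -- the second source term is controlled by Fatou's lemma
  have hfatou : ∫⁻ x in Ω, ENNReal.ofReal (g₂ x * ψ₂ x) ≤
      ∫⁻ x in Ω, ENNReal.ofReal (g₁ x * ψ₁ x) := by
    rw [← ofReal_integral_eq_lintegral_ofReal hi₁ hψ₁0]
    refine lintegral_le_of_ae_tendsto
      (f := fun n x => ENNReal.ofReal (g₂ x * piconeSnd p (ε n) (v₁ x, v₂ x)))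
      (B := fun n => ENNReal.ofReal
        ((∫ x in Ω, g₁ x * piconeFst p (ε n) (v₁ x, v₂ x)) + ∫ x in Ω, E n x))
      (fun n => (hid₂ n).1.aestronglyMeasurable.aemeasurable.ennreal_ofReal) ?_ (fun n => ?_) ?_
    · filter_upwards [hlim₂] with x hx using ENNReal.tendsto_ofReal hx
    · rw [← ofReal_integral_eq_lintegral_ofReal (hid₂ n).1]
      · exact ENNReal.ofReal_le_ofReal (hineq n)
      · filter_upwards [hpos₁, hpos₂, hY₂.nonneg] with x hx₁ hx₂ hg
        exact mul_nonneg hg (piconeSnd_nonneg (hε0 n) ⟨hx₁.le, hx₂.le⟩)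
    · refine ENNReal.tendsto_ofReal ?_
      simpa using hconv.add hElim
  have hrew : ∀ {g v W : ℝ}, 0 < v → g * (W * v ^ (1 - p)) = W * (g / v ^ (p - 1)) := by
    intro g v W hv
    rw [← neg_sub p 1, Real.rpow_neg hv.le]
    ring
  have hgap : ∀ {x}, 0 < v₂ x → v₂ x < v₁ x → 0 < max (v₁ x ^ p - v₂ x ^ p) 0 :=
    fun hx₂ hx => lt_max_of_lt_left (sub_pos.2 (Real.rpow_lt_rpow hx₂.le hx hp0))
  have hle : (fun x => ENNReal.ofReal (g₁ x * ψ₁ x)) ≤ᵐ[volume.restrict Ω]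
      fun x => ENNReal.ofReal (g₂ x * ψ₂ x) := by
    filter_upwards [hpos₁, hpos₂, hlt] with x hx₁ hx₂ hx
    refine ENNReal.ofReal_le_ofReal ?_
    simp only [hψ₁, hψ₂]
    rcases le_or_gt (v₁ x) (v₂ x) with h | h
    · rw [max_eq_right (sub_nonpos.2 (Real.rpow_le_rpow hx₁.le h hp0.le))]
      simp
    · rw [hrew hx₁, hrew hx₂]
      exact mul_le_mul_of_nonneg_left (hx h).le (le_max_right _ _)
  have hm₂ : AEMeasurable (fun x => ENNReal.ofReal (g₂ x * ψ₂ x)) (volume.restrict Ω) :=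
    (aestronglyMeasurable_of_tendsto_ae atTop (fun n => (hid₂ n).1.aestronglyMeasurable)
      hlim₂).aemeasurable.ennreal_ofReal
  have hfin : ∫⁻ x in Ω, ENNReal.ofReal (g₁ x * ψ₁ x) ≠ ⊤ := by
    rw [← ofReal_integral_eq_lintegral_ofReal hi₁ hψ₁0]
    exact ENNReal.ofReal_ne_top
  have heq := ae_eq_of_ae_le_of_lintegral_le hle hfin hm₂ hfatou
  filter_upwards [heq, hpos₁, hpos₂, hlt, hY₁.nonneg] with x hx hx₁ hx₂ hlt hg
  by_contra! h
  have h1 : g₁ x * ψ₁ x < g₂ x * ψ₂ x := by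
    simp only [hψ₁, hψ₂]
    rw [hrew hx₁, hrew hx₂]
    exact mul_lt_mul_of_pos_left (hlt h) (hgap hx₂ h)
  have h0 : 0 ≤ g₁ x * ψ₁ x :=
    mul_nonneg hg (mul_nonneg (le_max_right _ _) (Real.rpow_nonneg hx₁.le _))
  exact ((ENNReal.ofReal_lt_ofReal_iff (h0.trans_lt h1)).2 h1).ne hx

end

theorem mainTheorem7 (N : ℕ) (p : ℝ) (hp : 1 < p) (hpN : p < (N : ℝ))
    (H : EuclideanSpace ℝ (Fin N) → ℝ) (hH : IsEllipticFinsler H)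
    (Ω : Set (EuclideanSpace ℝ (Fin N))) (hΩ : IsOpen Ω) (hΩb : Bornology.IsBounded Ω)
    (G₁ G₂ : EuclideanSpace ℝ (Fin N) → ℝ → ℝ)
    (hG₁ : IsNonnegCaratheodory Ω G₁) (hG₂ : IsNonnegCaratheodory Ω G₂)
    (hdecr : (∀ᵐ x ∂(volume.restrict Ω), StrictAntiOn (fun s : ℝ => G₁ x s / s ^ (p - 1)) (Ioi 0)) ∨
      (∀ᵐ x ∂(volume.restrict Ω), StrictAntiOn (fun s : ℝ => G₂ x s / s ^ (p - 1)) (Ioi 0)))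
    (hle : ∀ᵐ x ∂(volume.restrict Ω), ∀ s : ℝ, 0 < s → G₁ x s ≤ G₂ x s)
    (v₁ v₂ : EuclideanSpace ℝ (Fin N) → ℝ)
    (hv₁ : IsWeakSolution p H Ω G₁ v₁) (hv₂ : IsWeakSolution p H Ω G₂ v₂) :
    ∀ᵐ x ∂(volume.restrict Ω), v₁ x ≤ v₂ x := by
  obtain ⟨hpos₁, hloc₁, V₁, hS₁, hw₁⟩ := hv₁
  obtain ⟨hpos₂, hloc₂, V₂, hS₂, hw₂⟩ := hv₂
  have hnonneg : ∀ {G : EuclideanSpace ℝ (Fin N) → ℝ → ℝ} {v : EuclideanSpace ℝ (Fin N) → ℝ},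
      IsNonnegCaratheodory Ω G → (∀ᵐ x ∂(volume.restrict Ω), 0 < v x) →
      ∀ᵐ x ∂(volume.restrict Ω), 0 ≤ G x (v x) := by
    intro G v hG hv
    filter_upwards [hv, ae_restrict_mem hΩ.measurableSet] with x hx hxΩ
    exact hG.nonneg x hxΩ _ hx
  have hflux : ∀ {v : EuclideanSpace ℝ (Fin N) → ℝ}
      {V : EuclideanSpace ℝ (Fin N) → EuclideanSpace ℝ (Fin N)}, MemSobolevZero p Ω v V →
      AEStronglyMeasurable (fun x => finslerFlux p H (V x)) (volume.restrict Ω) := fun hV =>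
    (hH.measurable_finslerFlux.comp_aemeasurable
      hV.memLp_grad.aestronglyMeasurable.aemeasurable).aestronglyMeasurable
  refine ae_le_of_forall_div_lt hp hH hS₁ hS₂ hpos₁ hpos₂
    ⟨hnonneg hG₁ hpos₁, hloc₁, hflux hS₁, hw₁⟩ ⟨hnonneg hG₂ hpos₂, hloc₂, hflux hS₂, hw₂⟩ ?_
  rcases hdecr with hdecr | hdecr
  · filter_upwards [hdecr, hle, hpos₁, hpos₂] with x hx hlex hx₁ hx₂ h
    exact (hx hx₂ hx₁ h).trans_le
      (div_le_div_of_nonneg_right (hlex _ hx₂) (Real.rpow_nonneg hx₂.le _))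
  · filter_upwards [hdecr, hle, hpos₁, hpos₂] with x hx hlex hx₁ hx₂ h
    exact (div_le_div_of_nonneg_right (hlex _ hx₁) (Real.rpow_nonneg hx₁.le _)).trans_lt
      (hx hx₂ hx₁ h)
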